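/- **Theorem 1.3.** Let $M=\mathbb S^2\times\mathbb S^1$, let $(r,\theta)\in[0,2]\times[0,2\pi]$ be the polar coordinates on the unit sphere $\mathbb S^2$ given by $(r,\theta)\mapsto(\sin\tfrac{\pi r}{2}\cos\theta,\ \sin\tfrac{\pi r}{2}\sin\theta,\ \cos\tfrac{\pi r}{2})$, and let $\xi\in[0,2\pi]$ be the coordinate on $\mathbb S^1$. Let $$g_i=\varphi_i^{-2}\,(dr^2+u_i(r)^2\,d\theta^2)+\varphi_i^2\,d\xi^2,\qquad i\in\mathbb N,$$ be a sequence of smooth Riemannian metrics on $M$, where $\varphi_i\in C^\infty(\mathbb S^2)$, $\varphi_i>0$, and $u_i\in C^\infty([0,2])$ satisfies $u_i>0$ on $(0,2)$, $u_i(0)=u_i(2)=0$, $u_i'(0)=1$, $u_i'(2)=-1$ (and, as smoothness of $dr^2+u_i^2d\theta^2$ at the poles requires, all derivatives of $u_i$ of even order vanish at $0$ and $2$). Suppose that there are constants $V_0$ and $A_0>0$ such that, for all $i$, $$\operatorname{Scalar}_{g_i}\ge 0,\qquad \operatorname{Vol}_{g_i}(M)\le V_0,\qquad \operatorname{MinA}(M,g_i)=\inf\{\operatorname{Area}_{g_i}(\Sigma):\Sigma\text{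 a closed embedded minimal surface in }(M,g_i)\}\ge A_0 .$$ Then, after passing to a subsequence, there are functions $u_\infty$ on $[0,2]$ and $\varphi_\infty$ on $\mathbb S^2$ minus the two poles, with $u_\infty>0$ on $(0,2)$ and $\varphi_\infty>0$, such that $u_i\to u_\infty$ uniformly on $[0,2]$, $\varphi_i\to\varphi_\infty$ uniformly on $\Omega_\varepsilon=\{\varepsilon\le r\le 2-\varepsilon\}\subset\mathbb S^2$ for every $0<\varepsilon<1$, and such that, with $$g_\infty=\varphi_\infty^{-2}\,(dr^2+u_\infty^2\,d\theta^2)+\varphi_\infty^2\,d\xi^2\quad\text{on }\{0<r<2\}\subset M,$$ the following hold. 1. For every $1\le p<\infty$, the tensors $g_i$ and $g_\infty$ belong to $L^p(M,g_0)$ and $g_i\to g_\infty$ in $L^p(M,g_0)$ as symmetric $2$-tensors, that is, $\int_M|g_i-g_\infty|_{g_0}^p\,d\mu_{g_0}\to0$, where $g_0=\tfrac{\pi^2}{4}dr^2+\sin^2(\tfrac{\pi r}{2})\,d\theta^2+d\xi^2$ is the standard product metric on $\mathbb S^2\times\mathbb S^1$. 2. For every $0<\varepsilon<1$, the coefficients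 of $g_i$ in the coordinates $(r,\theta,\xi)$ converge to those of $g_\infty$ uniformly on $M_\varepsilon=\Omega_\varepsilon\times\mathbb S^1$. -/

import Mathlib

open Filter Topology MeasureTheory Set
open scoped ENNReal ContDiff Manifold Matrix

noncomputable section

namespace WarpedS2S1

/-! ### The manifold `M = 𝕊² × 𝕊¹` and its coordinates `(r, θ, ξ)` -/

/-- The unit sphere in `ℝ³`, with its standard smooth structure from Mathlib. -/
abbrev S2 : Type := Metric.sphere (0 : EuclideanSpace ℝ (Fin 3)) 1

instance factFinrankThree : Fact (Module.finrank ℝ (EuclideanSpace ℝ (Fin 3)) = 2 + 1) :=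
  ⟨by simp⟩

/-- The closed three-manifold `𝕊² × 𝕊¹`, with its standard smooth structure from Mathlib. -/
abbrev M : Type := S2 × Circle

/-- The model with corners of `M`. -/
abbrev modelM := (𝓡 2).prod (𝓡 1)

/-- Polar coordinates on the sphere, with radial parameter `r ∈ [0, 2]` and angle `θ`.
The poles are `r = 0` and `r = 2`. -/
def polarPt (r θ : ℝ) : S2 :=
  ⟨!₂[Real.sin (Real.pi * r / 2) * Real.cos θ, Real.sin (Real.pi * r / 2) * Real.sin θ,
      Real.cos (Real.pi * r / 2)], by
    have h1 := Real.sin_sq_add_cos_sq (Real.pi * r / 2)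
    have h2 := Real.sin_sq_add_cos_sq θ
    rw [mem_sphere_zero_iff_norm, EuclideanSpace.norm_eq, Real.sqrt_eq_one]
    simp only [Fin.sum_univ_three, Real.norm_eq_abs, sq_abs]
    simp
    linear_combination h1 + (Real.sin (Real.pi * r / 2)) ^ 2 * h2⟩

/-- The space of coordinate vectors `x = (r, θ, ξ)`. -/
abbrev Coord : Type := Fin 3 → ℝ

/-- The coordinate map `(r, θ, ξ) ↦ (polarPt r θ, e^{iξ})`.  On `{0 < r < 2}` it is a local
diffeomorphism onto `M` minus the two polar circles `r = 0` and `r = 2`. -/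
def coordMap (x : Coord) : M := (polarPt (x 0) (x 1), Circle.exp (x 2))

/-- The coordinate region `0 < r < 2` (the angles `θ`, `ξ` are arbitrary reals). -/
def strip : Set Coord := {x | 0 < x 0 ∧ x 0 < 2}

/-- The fundamental domain `0 < r < 2`, `0 < θ < 2π`, `0 < ξ < 2π`.  Its image under `coordMap`
is `M` up to a null set. -/
def box : Set Coord :=
  {x | x 0 ∈ Ioo 0 2 ∧ x 1 ∈ Ioo 0 (2 * Real.pi) ∧ x 2 ∈ Ioo 0 (2 * Real.pi)}

/-! ### Riemannian geometry in coordinates -/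

/-- A symmetric `2`-tensor in coordinates: its matrix of components at each point. -/
abbrev CoordTensor : Type := Coord → Matrix (Fin 3) (Fin 3) ℝ

/-- The partial derivative `∂ₐ f`. -/
def pd (a : Fin 3) (f : Coord → ℝ) (x : Coord) : ℝ := fderiv ℝ f x (Pi.single a 1)

/-- The Christoffel symbols `Γᵏᵢⱼ = ½ gᵏˡ (∂ᵢ gⱼₗ + ∂ⱼ gᵢₗ - ∂ₗ gᵢⱼ)`. -/
def christoffel (G : CoordTensor) (k i j : Fin 3) (x : Coord) : ℝ :=
  (1 / 2) * ∑ l, (G x)⁻¹ k l *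
    (pd i (fun y => G y j l) x + pd j (fun y => G y i l) x - pd l (fun y => G y i j) x)

/-- The scalar curvature
`gⁱʲ (∂ₖ Γᵏᵢⱼ - ∂ᵢ Γᵏₖⱼ + Γˡᵢⱼ Γᵏₖₗ - Γˡₖⱼ Γᵏᵢₗ)`. -/
def scalarCurvature (G : CoordTensor) (x : Coord) : ℝ :=
  ∑ i, ∑ j, (G x)⁻¹ i j *
    ((∑ k, pd k (christoffel G k i j) x) - (∑ k, pd i (christoffel G k k j) x)
      + (∑ k, ∑ l, christoffel G l i j x * christoffel G k k l x)
      - (∑ k, ∑ l, christoffel G l k j x * christoffel G k i l x))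

/-- The Riemannian volume measure `√(det g) dr dθ dξ` on the fundamental domain. -/
def volMeasure (G : CoordTensor) : Measure Coord :=
  (volume.restrict box).withDensity fun x => ENNReal.ofReal (√ (G x).det)

/-- The volume of `M`; the polar circles are null sets. -/
def vol (G : CoordTensor) : ℝ≥0∞ := volMeasure G univ

/-- The norm `|∇f|_g = (gᵏˡ ∂ₖf ∂ₗf)^{1/2}` of the gradient. -/
def gradNorm (G : CoordTensor) (f : Coord → ℝ) (x : Coord) : ℝ :=
  √ (∑ k, ∑ l, (G x)⁻¹ k l * pd k f x * pd l f x)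

/-- The mean curvature of the level set of `f` through `x` with respect to the unit normal
`ν = ∇f / |∇f|_g`, that is `div_g ν = (det g)^{-1/2} ∂ᵢ ((det g)^{1/2} νⁱ)`. -/
def meanCurvature (G : CoordTensor) (f : Coord → ℝ) (x : Coord) : ℝ :=
  (√ (G x).det)⁻¹ *
    ∑ i, pd i (fun y => √ (G y).det * ((∑ j, (G y)⁻¹ i j * pd j f y) / gradNorm G f y)) x

/-! ### Closed minimal surfaces, area and `MinA` -/

/-- `f` is a smooth local defining function, on the open set `W`, of the surface `S` in `M`. -/
structure IsDefiningFunction (S W : Set M) (f : M → ℝ) : Prop where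
  isOpen : IsOpen W
  smooth : ContMDiffOn modelM 𝓘(ℝ, ℝ) ∞ f W
  submersion : ∀ q ∈ S ∩ W, mfderiv modelM 𝓘(ℝ, ℝ) f q ≠ 0
  eq_zeroSet : S ∩ W = {q ∈ W | f q = 0}

/-- `S` is a closed (compact without boundary, non-empty) smooth embedded surface in `M` whose
mean curvature vanishes.  For a metric that is smooth on `M` the mean curvature is continuous on
`S`, and the points of `S` off the two polar circles are dense in `S`, so that it is enough to
compute it at these points, where the coordinates `(r, θ, ξ)` are available. -/
structure IsClosedMinimalSurface (G : CoordTensor) (S : Set M) : Prop where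
  isClosed : IsClosed S
  nonempty : S.Nonempty
  minimal : ∀ p ∈ S, ∃ (W : Set M) (f : M → ℝ), p ∈ W ∧ IsDefiningFunction S W f ∧
    ∀ x ∈ strip, coordMap x ∈ S ∩ W → meanCurvature G (f ∘ coordMap) x = 0

/-- A countable parametrization of the part of `S` off the polar circles: smooth maps `Y n`, each
defined on an open set `U n` of the plane and given in the coordinates `(r, θ, ξ)`, and Borel sets
`B n ⊆ U n` whose images together make up that part of `S`. -/
structure IsParametrization (S : Set M) (U : ℕ → Set (Fin 2 → ℝ))
    (Y : ℕ → (Fin 2 → ℝ) → Coord) (B : ℕ → Set (Fin 2 → ℝ)) : Prop where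
  isOpen : ∀ n, IsOpen (U n)
  smooth : ∀ n, ContDiffOn ℝ ∞ (Y n) (U n)
  mapsTo : ∀ n, MapsTo (Y n) (U n) strip
  subset : ∀ n, B n ⊆ U n
  measurable : ∀ n, MeasurableSet (B n)
  iUnion_eq : ⋃ n, (coordMap ∘ Y n) '' B n = S ∩ coordMap '' strip

/-- The area density `√(det (g(∂_α Y, ∂_β Y)))` of a parametrized surface. -/
def areaDensity (G : CoordTensor) (Y : (Fin 2 → ℝ) → Coord) (s : Fin 2 → ℝ) : ℝ :=
  √ (Matrix.of fun α β : Fin 2 =>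
      fderiv ℝ Y s (Pi.single α 1) ⬝ᵥ (G (Y s) *ᵥ fderiv ℝ Y s (Pi.single β 1))).det

/-- The area of a smooth surface `S`: the sum of the integrals of the area density over the pieces
of a parametrization.  A piece that covers a point of `S` several times counts it several times,
so the area is the infimum; it is attained by any parametrization that is one-to-one.  The polar
circles meet `S` in a set of zero area. -/
def area (G : CoordTensor) (S : Set M) : ℝ≥0∞ :=
  ⨅ (U : ℕ → Set (Fin 2 → ℝ)) (Y : ℕ → (Fin 2 → ℝ) → Coord) (B : ℕ → Set (Fin 2 → ℝ))
    (_ : IsParametrization S U Y B),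
    ∑' n, ∫⁻ s in B n, ENNReal.ofReal (areaDensity G (Y n) s)

/-- `MinA`: the infimum of the areas of the closed minimal surfaces. -/
def minA (G : CoordTensor) : ℝ≥0∞ :=
  ⨅ (S : Set M) (_ : IsClosedMinimalSurface G S), area G S

/-! ### The warped product metrics -/

/-- The metric `φ⁻² (dr² + u² dθ²) + φ² dξ²` in the coordinates `(r, θ, ξ)`. -/
def warpedMetric (u : ℝ → ℝ) (φ : S2 → ℝ) : CoordTensor := fun x =>
  Matrix.diagonal ![(φ (polarPt (x 0) (x 1)) ^ 2)⁻¹,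
    (φ (polarPt (x 0) (x 1)) ^ 2)⁻¹ * u (x 0) ^ 2,
    φ (polarPt (x 0) (x 1)) ^ 2]

/-- The conditions under which `dr² + u² dθ²`, `r ∈ [0, 2]`, is a smooth rotationally symmetric
Riemannian metric on the sphere (the last two fields say that `u` is odd to infinite order at each
pole) and `φ` is a smooth positive function on the sphere; equivalently, under which
`warpedMetric u φ` is a smooth Riemannian metric on `M`. -/
structure IsWarpingPair (u : ℝ → ℝ) (φ : S2 → ℝ) : Prop where
  u_smooth : ContDiffOn ℝ ∞ u (Icc 0 2)
  u_zero : u 0 = 0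
  u_two : u 2 = 0
  u_pos : ∀ r ∈ Ioo (0 : ℝ) 2, 0 < u r
  deriv_zero : derivWithin u (Icc 0 2) 0 = 1
  deriv_two : derivWithin u (Icc 0 2) 2 = -1
  even_deriv_zero : ∀ k : ℕ, iteratedDerivWithin (2 * k) u (Icc 0 2) 0 = 0
  even_deriv_two : ∀ k : ℕ, iteratedDerivWithin (2 * k) u (Icc 0 2) 2 = 0
  φ_smooth : ContMDiff (𝓡 2) 𝓘(ℝ, ℝ) ∞ φ
  φ_pos : ∀ q, 0 < φ q

/-! ### Convergence of tensors -/

/-- The standard product metric on `𝕊² × 𝕊¹` (unit sphere, circle of length `2π`) in the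
coordinates `(r, θ, ξ)`: the pull-back `(π/2)² dr² + sin²(πr/2) dθ² + dξ²` of the Euclidean
metric of `ℝ³ × ℂ` under `coordMap`. -/
def stdMetric : CoordTensor := fun x =>
  Matrix.diagonal ![(Real.pi / 2) ^ 2, Real.sin (Real.pi * x 0 / 2) ^ 2, 1]

/-- The pointwise norm `|T|_{g₀} = (g₀ᵃᵇ g₀ᶜᵈ T_{ac} T_{bd})^{1/2}` of a symmetric `2`-tensor. -/
def tensorNorm (T : CoordTensor) (x : Coord) : ℝ :=
  √ ((stdMetric x)⁻¹ * T x * (stdMetric x)⁻¹ * T x).trace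

/-- `T ∈ Lᵖ(M, g₀)`, for a symmetric `2`-tensor `T`. -/
def MemTensorLp (T : CoordTensor) (p : ℝ≥0∞) : Prop :=
  (∀ a b, AEStronglyMeasurable (fun x => T x a b) (volMeasure stdMetric)) ∧
    MemLp (tensorNorm T) p (volMeasure stdMetric)

/-- `T i → T'` in `Lᵖ(M, g₀)`, for symmetric `2`-tensors. -/
def TendstoTensorLp (T : ℕ → CoordTensor) (T' : CoordTensor) (p : ℝ≥0∞) : Prop :=
  (∀ i, MemTensorLp (T i) p) ∧ MemTensorLp T' p ∧
    Tendsto (fun i => eLpNorm (tensorNorm (T i - T')) p (volMeasure stdMetric)) atTop (𝓝 0)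

/-- The region `Ω_ε = {ε ≤ r ≤ 2 - ε}` of the sphere. -/
def OmegaEps (ε : ℝ) : Set S2 := {q | ∃ r ∈ Icc ε (2 - ε), ∃ θ : ℝ, q = polarPt r θ}

/-- The interior region `M_ε = Ω_ε × 𝕊¹`, in the coordinates `(r, θ, ξ)`. -/
def MEps (ε : ℝ) : Set Coord := {x | x 0 ∈ Icc ε (2 - ε)}

end WarpedS2S1

end

/-!
Write `φ = e^f`. Nonnegative scalar curvature of `e^{-2f} (dr² + u² dθ²) + e^{2f} dξ²` amounts to
`u (∂_r f)² + (∂_θ f)² / u ≤ -u''`. Hence `u` is concave with `|u'| ≤ 1`, which gives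
Arzelà–Ascoli compactness for `u`, and `∫ -u'' = 2`. Where `u' (c) = 0`, the torus `r = c` is
minimal and has area `4π² u(c)`, so `u(c) ≥ A₀ / 4π²` and concavity gives `u ≥ κ r (2 - r)`
with `κ = A₀ / 16π²`.

By Cauchy–Schwarz, `∫ |∂_r f| ≤ √(∫ 1/u · ∫ u (∂_r f)²)`, so the oscillation of `f` in `r` is at
most a multiple of the root of that of `L(r) = log (r / (2 - r))`, as `L' = 2 / (r (2 - r))`.
The oscillation in `θ` is controlled on some circle near any given one, where `-u''` is bounded by
the mean value theorem. The volume bound keeps `f(1, 0)` from being too small, and the area of the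
minimal sphere `ξ = 0` keeps it from being too large. So `|f| ≤ C_η + η |L|` for every `η > 0`, with
`C_η` independent of `i`: this gives local uniform convergence away from the poles and, as
`e^{|L|} ≤ 4 / (r (2 - r))` is integrable against `dμ_{g₀}`, dominated convergence in every `Lᵖ`.
-/

noncomputable section

open scoped Real

namespace WarpedS2S1

/-! ### Partial derivatives -/

section PartialDerivatives

variable {a : Fin 3} {f g : Coord → ℝ} {x : Coord}

lemma pd_congr (h : f =ᶠ[𝓝 x] g) : pd a f x = pd a g x := by
  rw [pd, pd, h.fderiv_eq]

lemma pd_const (c : ℝ) : pd a (fun _ => c) x = 0 := by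
  simp [pd]

lemma pd_neg : pd a (fun y => -f y) x = -pd a f x := by
  simp [pd, fderiv_fun_neg]

lemma pd_add (hf : DifferentiableAt ℝ f x) (hg : DifferentiableAt ℝ g x) :
    pd a (fun y => f y + g y) x = pd a f x + pd a g x := by
  simp [pd, fderiv_fun_add hf hg]

lemma pd_sub (hf : DifferentiableAt ℝ f x) (hg : DifferentiableAt ℝ g x) :
    pd a (fun y => f y - g y) x = pd a f x - pd a g x := by
  simp [pd, fderiv_fun_sub hf hg]

lemma pd_mul (hf : DifferentiableAt ℝ f x) (hg : DifferentiableAt ℝ g x) :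
    pd a (fun y => f y * g y) x = f x * pd a g x + g x * pd a f x := by
  simp [pd, fderiv_fun_mul hf hg]

lemma pd_pow (hf : DifferentiableAt ℝ f x) (n : ℕ) :
    pd a (fun y => f y ^ n) x = n * f x ^ (n - 1) * pd a f x := by
  simp [pd, fderiv_fun_pow n hf]

lemma pd_inv (hf : DifferentiableAt ℝ f x) (hx : f x ≠ 0) :
    pd a (fun y => (f y)⁻¹) x = -pd a f x / f x ^ 2 := by
  have h : HasFDerivAt (fun y => (f y)⁻¹) _ x :=
    (hasDerivAt_inv hx).comp_hasFDerivAt x hf.hasFDerivAt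
  rw [pd, h.fderiv, pd, smul_apply, smul_eq_mul]
  ring

lemma pd_exp_const_mul (c : ℝ) (hf : DifferentiableAt ℝ f x) :
    pd a (fun y => Real.exp (c * f y)) x = c * pd a f x * Real.exp (c * f x) := by
  simp only [pd, fderiv_exp (hf.const_mul c), fderiv_const_mul hf,
    smul_apply, smul_eq_mul]
  ring

lemma pd_comp_coord {w : ℝ → ℝ} {b : Fin 3} (hw : DifferentiableAt ℝ w (x b)) :
    pd a (fun y => w (y b)) x = if b = a then deriv w (x b) else 0 := by
  have h : HasFDerivAt (fun y : Coord => w (y b)) _ x :=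
    hw.hasDerivAt.comp_hasFDerivAt x (ContinuousLinearMap.proj b : Coord →L[ℝ] ℝ).hasFDerivAt
  rw [pd, h.fderiv]
  simp [Pi.single_apply]

lemma pd_eq_deriv_update (hf : DifferentiableAt ℝ f x) :
    pd a f x = deriv (fun t => f (Function.update x a t)) (x a) := by
  have hf' : HasFDerivAt f (fderiv ℝ f x) (Function.update x a (x a)) := by
    simpa using hf.hasFDerivAt
  exact (hf'.comp_hasDerivAt (x a) (hasDerivAt_update x a (x a))).deriv.symm

lemma pd_eq_zero_of_forall_update (h : ∀ t, f (Function.update x a t) = f x) : pd a f x = 0 := by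
  by_cases hf : DifferentiableAt ℝ f x
  · simp [pd_eq_deriv_update hf, h]
  · simp [pd, fderiv_zero_of_not_differentiableAt hf]

lemma contDiffAt_pd (hf : ContDiffAt ℝ ∞ f x) : ContDiffAt ℝ ∞ (pd a f) x :=
  (hf.fderiv_right (m := ∞) (by simp)).clm_apply contDiffAt_const

end PartialDerivatives

lemma inv_diagonal_of_forall_ne_zero {ι K : Type*} [Fintype ι] [DecidableEq ι] [Field K]
    {d : ι → K} (hd : ∀ i, d i ≠ 0) : (Matrix.diagonal d)⁻¹ = Matrix.diagonal d⁻¹ := by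
  refine Matrix.inv_eq_right_inv ?_
  rw [Matrix.diagonal_mul_diagonal, ← Matrix.diagonal_one]
  exact congrArg _ (funext fun i => mul_inv_cancel₀ (hd i))

/-! ### Scalar curvature -/

section ScalarCurvature

lemma scalarCurvature_eq_of_christoffel {G : CoordTensor} {x : Coord}
    {Γ : Coord → Fin 3 → Fin 3 → Fin 3 → ℝ}
    (h : ∀ᶠ y in 𝓝 x, ∀ k i j, christoffel G k i j y = Γ y k i j) :
    scalarCurvature G x = ∑ i, ∑ j, (G x)⁻¹ i j *
      ((∑ k, pd k (fun y => Γ y k i j) x) - (∑ k, pd i (fun y => Γ y k k j) x)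
        + (∑ k, ∑ l, Γ x l i j * Γ x k k l) - (∑ k, ∑ l, Γ x l k j * Γ x k i l)) := by
  have hpd (a k i j) : pd a (christoffel G k i j) x = pd a (fun y => Γ y k i j) x :=
    pd_congr (h.mono fun y hy => hy k i j)
  simp only [scalarCurvature, hpd, h.self_of_nhds]

variable {f v : Coord → ℝ}

/-- The metric `e^{-2f} (dr² + v² dθ²) + e^{2f} dξ²`: the warped product metric in terms of
`f = log φ`. -/
def expMetric (f v : Coord → ℝ) : CoordTensor := fun x =>
  Matrix.diagonal ![Real.exp (-2 * f x), Real.exp (-2 * f x) * v x ^ 2, Real.exp (2 * f x)]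

/-- The Christoffel symbols `Γᵏᵢⱼ` of `expMetric f v` when `f` does not depend on `ξ` and `v`
depends on `r` only, as a table indexed by `k`, `i`, `j`. -/
def expChristoffel (f v : Coord → ℝ) (x : Coord) : Fin 3 → Fin 3 → Fin 3 → ℝ :=
  ![![![-pd 0 f x, -pd 1 f x, 0], ![-pd 1 f x, pd 0 f x * v x ^ 2 - v x * pd 0 v x, 0],
      ![0, 0, -(pd 0 f x * Real.exp (4 * f x))]],
    ![![pd 1 f x * (v x ^ 2)⁻¹, -pd 0 f x + pd 0 v x * (v x)⁻¹, 0],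
      ![-pd 0 f x + pd 0 v x * (v x)⁻¹, -pd 1 f x, 0],
      ![0, 0, -(pd 1 f x * (v x ^ 2)⁻¹ * Real.exp (4 * f x))]],
    ![![0, 0, pd 0 f x], ![0, 0, pd 1 f x], ![pd 0 f x, pd 1 f x, 0]]]

lemma inv_expMetric {x : Coord} (hvx : v x ≠ 0) :
    (expMetric f v x)⁻¹ = Matrix.diagonal ![Real.exp (2 * f x),
      Real.exp (2 * f x) * (v x ^ 2)⁻¹, (Real.exp (2 * f x))⁻¹] := by
  rw [expMetric, inv_diagonal_of_forall_ne_zero]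
  · congr 1
    ext i
    fin_cases i <;> simp [Real.exp_neg, mul_comm]
  · intro i
    fin_cases i <;> simp [hvx]

lemma exp_four_mul (t : ℝ) : Real.exp (4 * t) = Real.exp (2 * t) ^ 2 := by
  rw [← Real.exp_nat_mul]
  ring_nf

lemma exp_neg_two_mul (t : ℝ) : Real.exp (-2 * t) = (Real.exp (2 * t))⁻¹ := by
  rw [neg_mul, Real.exp_neg]

lemma christoffel_expMetric {x : Coord} (hf : DifferentiableAt ℝ f x) (hv : DifferentiableAt ℝ v x)
    (hvx : v x ≠ 0) (hf2 : pd 2 f x = 0) (hv1 : pd 1 v x = 0) (hv2 : pd 2 v x = 0)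
    (k i j : Fin 3) : christoffel (expMetric f v) k i j x = expChristoffel f v x k i j := by
  have hpd (a) : pd a (fun y => Real.exp (-2 * f y) * v y ^ 2) x
      = Real.exp (-2 * f x) * (2 * v x * pd a v x - 2 * pd a f x * v x ^ 2) := by
    rw [pd_mul (by fun_prop) (by fun_prop), pd_exp_const_mul _ hf, pd_pow hv]
    norm_num
    ring
  have hE : Real.exp (2 * f x) ≠ 0 := (Real.exp_pos _).ne'
  rw [christoffel, inv_expMetric hvx]
  fin_cases k <;> fin_cases i <;> fin_cases j <;>
    simp [Matrix.diagonal_apply, expMetric, expChristoffel, hpd, pd_exp_const_mul _ hf, pd_const,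
      hf2, hv1, hv2, exp_four_mul, exp_neg_two_mul (f x), -neg_mul] <;> field_simp <;> ring

theorem scalarCurvature_expMetric {O : Set Coord} (hO : IsOpen O) (hf : ContDiffOn ℝ ∞ f O)
    (hv : ContDiffOn ℝ ∞ v O) (hv0 : ∀ x ∈ O, v x ≠ 0) (hf2 : ∀ x ∈ O, pd 2 f x = 0)
    (hv1 : ∀ x ∈ O, pd 1 v x = 0) (hv2 : ∀ x ∈ O, pd 2 v x = 0) {x : Coord} (hx : x ∈ O) :
    scalarCurvature (expMetric f v) x = 2 * Real.exp (2 * f x) *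
      (-(pd 0 (pd 0 v) x) / v x - pd 0 f x ^ 2 - pd 1 f x ^ 2 / v x ^ 2) := by
  have hfO (y) (hy : y ∈ O) : ContDiffAt ℝ ∞ f y := hf.contDiffAt (hO.mem_nhds hy)
  have hvO (y) (hy : y ∈ O) : ContDiffAt ℝ ∞ v y := hv.contDiffAt (hO.mem_nhds hy)
  have hΓ : ∀ᶠ y in 𝓝 x, ∀ k i j,
      christoffel (expMetric f v) k i j y = expChristoffel f v y k i j := by
    filter_upwards [hO.mem_nhds hx] with y hy
    exact christoffel_expMetric ((hfO y hy).differentiableAt (by simp))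
      ((hvO y hy).differentiableAt (by simp)) (hv0 y hy) (hf2 y hy) (hv1 y hy) (hv2 y hy)
  have df : DifferentiableAt ℝ f x := (hfO x hx).differentiableAt (by simp)
  have dv : DifferentiableAt ℝ v x := (hvO x hx).differentiableAt (by simp)
  have dpf (a) : DifferentiableAt ℝ (pd a f) x :=
    (contDiffAt_pd (hfO x hx)).differentiableAt (by simp)
  have dpv (a) : DifferentiableAt ℝ (pd a v) x :=
    (contDiffAt_pd (hvO x hx)).differentiableAt (by simp)
  have hvx : v x ≠ 0 := hv0 x hx
  have hvx2 : v x ^ 2 ≠ 0 := pow_ne_zero 2 hvx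
  rw [scalarCurvature_eq_of_christoffel hΓ, inv_expMetric hvx]
  simp only [expChristoffel, Fin.sum_univ_three, Matrix.diagonal_apply]
  simp (disch := first | fun_prop (disch := assumption) | assumption)
    [pd_const, pd_neg, pd_add, pd_sub, pd_mul, pd_pow, pd_inv, pd_exp_const_mul, hv1 x hx,
      exp_four_mul]
  field_simp
  ring

end ScalarCurvature

/-! ### Polar coordinates -/

section PolarCoordinates

variable {E : Type*} [NormedAddCommGroup E] [NormedSpace ℝ E]

lemma contMDiff_polarPt {r θ : E → ℝ} (hr : ContDiff ℝ ∞ r) (hθ : ContDiff ℝ ∞ θ) :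
    ContMDiff 𝓘(ℝ, E) (𝓡 2) ∞ (fun x => polarPt (r x) (θ x)) := by
  unfold polarPt
  apply ContMDiff.codRestrict_sphere
  rw [contMDiff_iff_contDiff, contDiff_euclidean]
  intro i
  fin_cases i <;> dsimp <;> fun_prop

lemma contMDiff_coordMap {y : E → Coord} (hy : ContDiff ℝ ∞ y) :
    ContMDiff 𝓘(ℝ, E) modelM ∞ (fun x => coordMap (y x)) := by
  have h (a) : ContDiff ℝ ∞ (fun x => y x a) := by fun_prop
  exact (contMDiff_polarPt (h 0) (h 1)).prodMk
    ((contMDiff_circleExp.of_le le_top).comp (h 2).contMDiff)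

lemma polarPt_add_int_mul_two_pi (r θ : ℝ) (n : ℤ) :
    polarPt r (θ + n * (2 * π)) = polarPt r θ := by
  simp [polarPt, Real.sin_add_int_mul_two_pi, Real.cos_add_int_mul_two_pi]

lemma exists_add_int_mul_two_pi_mem_Icc (θ : ℝ) : ∃ n : ℤ, θ + n * (2 * π) ∈ Icc 0 (2 * π) := by
  refine ⟨-toIcoDiv Real.two_pi_pos 0 θ, ?_⟩
  have h := toIcoMod_mem_Ico' Real.two_pi_pos θ
  rw [toIcoMod, zsmul_eq_mul, sub_eq_add_neg, ← neg_mul] at h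
  exact_mod_cast Ico_subset_Icc_self h

/-- The function `log φ` in the coordinates `(r, θ)`. -/
def logPolar (φ : S2 → ℝ) (r θ : ℝ) : ℝ := Real.log (φ (polarPt r θ))

variable {u : ℝ → ℝ} {φ : S2 → ℝ} {r θ : E → ℝ}

lemma exp_logPolar (hφ : ∀ q, 0 < φ q) (r θ : ℝ) : Real.exp (logPolar φ r θ) = φ (polarPt r θ) :=
  Real.exp_log (hφ _)

lemma logPolar_add_int_mul_two_pi (r θ : ℝ) (n : ℤ) :
    logPolar φ r (θ + n * (2 * π)) = logPolar φ r θ := by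
  rw [logPolar, polarPt_add_int_mul_two_pi, logPolar]

lemma IsWarpingPair.contDiff_comp_polarPt (hw : IsWarpingPair u φ) (hr : ContDiff ℝ ∞ r)
    (hθ : ContDiff ℝ ∞ θ) : ContDiff ℝ ∞ (fun x => φ (polarPt (r x) (θ x))) :=
  (hw.φ_smooth.comp (contMDiff_polarPt hr hθ)).contDiff

lemma IsWarpingPair.contDiff_logPolar (hw : IsWarpingPair u φ) (hr : ContDiff ℝ ∞ r)
    (hθ : ContDiff ℝ ∞ θ) : ContDiff ℝ ∞ (fun x => logPolar φ (r x) (θ x)) :=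
  (hw.contDiff_comp_polarPt hr hθ).log fun _ => (hw.φ_pos _).ne'

end PolarCoordinates

lemma isOpen_strip : IsOpen strip :=
  isOpen_Ioo.preimage (continuous_apply (0 : Fin 3))

/-! ### The scalar curvature of the warped metric -/

section WarpedScalarCurvature

variable {u : ℝ → ℝ} {φ : S2 → ℝ} {r : ℝ}

lemma IsWarpingPair.contDiffAt (hw : IsWarpingPair u φ) (hr : r ∈ Ioo (0 : ℝ) 2) :
    ContDiffAt ℝ ∞ u r :=
  hw.u_smooth.contDiffAt (Icc_mem_nhds hr.1 hr.2)

lemma IsWarpingPair.differentiableAt (hw : IsWarpingPair u φ) (hr : r ∈ Ioo (0 : ℝ) 2) :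
    DifferentiableAt ℝ u r :=
  (hw.contDiffAt hr).differentiableAt (by simp)

lemma IsWarpingPair.contDiffAt_deriv (hw : IsWarpingPair u φ) (hr : r ∈ Ioo (0 : ℝ) 2) :
    ContDiffAt ℝ ∞ (deriv u) r :=
  ((hw.contDiffAt hr).fderiv_right (m := ∞) (by simp)).clm_apply contDiffAt_const

lemma IsWarpingPair.differentiableAt_deriv (hw : IsWarpingPair u φ) (hr : r ∈ Ioo (0 : ℝ) 2) :
    DifferentiableAt ℝ (deriv u) r :=
  (hw.contDiffAt_deriv hr).differentiableAt (by simp)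

lemma warpedMetric_eq_expMetric (hφ : ∀ q, 0 < φ q) :
    warpedMetric u φ = expMetric (fun x => logPolar φ (x 0) (x 1)) (fun x => u (x 0)) := by
  funext x
  have h : Real.exp (2 * logPolar φ (x 0) (x 1)) = φ (polarPt (x 0) (x 1)) ^ 2 := by
    rw [← exp_logPolar hφ, ← Real.exp_nat_mul]
    norm_num
  rw [warpedMetric, expMetric, exp_neg_two_mul, h]

theorem IsWarpingPair.scalarCurvature_warpedMetric (hw : IsWarpingPair u φ) {x : Coord}
    (hx : x ∈ strip) :
    scalarCurvature (warpedMetric u φ) x = 2 * Real.exp (2 * logPolar φ (x 0) (x 1)) *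
      (-deriv (deriv u) (x 0) / u (x 0) - deriv (fun r => logPolar φ r (x 1)) (x 0) ^ 2
        - deriv (fun θ => logPolar φ (x 0) θ) (x 1) ^ 2 / u (x 0) ^ 2) := by
  have hf : ContDiff ℝ ∞ fun x : Coord => logPolar φ (x 0) (x 1) :=
    hw.contDiff_logPolar (by fun_prop) (by fun_prop)
  have hv : ContDiffOn ℝ ∞ (fun x : Coord => u (x 0)) strip := fun x hx =>
    ((hw.contDiffAt hx).comp x (f := fun y : Coord => y 0) (by fun_prop)).contDiffWithinAt
  have hpv (y) (hy : y ∈ strip) (a) :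
      pd a (fun x : Coord => u (x 0)) y = if 0 = a then deriv u (y 0) else 0 :=
    pd_comp_coord (hw.differentiableAt hy)
  have hpf (a) := pd_eq_deriv_update (a := a) (hf.differentiable (by simp) x)
  have hpdv : pd 0 (pd 0 fun x : Coord => u (x 0)) x = deriv (deriv u) (x 0) := by
    have h : pd 0 (fun x : Coord => u (x 0)) =ᶠ[𝓝 x] fun y => deriv u (y 0) := by
      filter_upwards [isOpen_strip.mem_nhds hx] with y hy
      simp [hpv y hy]
    rw [pd_congr h, pd_comp_coord (hw.differentiableAt_deriv hx), if_pos rfl]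
  rw [warpedMetric_eq_expMetric hw.φ_pos, scalarCurvature_expMetric isOpen_strip hf.contDiffOn hv
    (fun y hy => (hw.u_pos _ hy).ne') (fun y _ => pd_eq_zero_of_forall_update (by simp))
    (fun y hy => by simp [hpv y hy]) (fun y hy => by simp [hpv y hy]) hx, hpdv]
  simp [hpf]

/-- The form that nonnegative scalar curvature takes for `warpedMetric u φ`, see
`IsWarpingPair.gradientBound`. -/
def GradientBound (u : ℝ → ℝ) (φ : S2 → ℝ) : Prop :=
  ∀ r ∈ Ioo (0 : ℝ) 2, ∀ θ,
    u r * deriv (fun s => logPolar φ s θ) r ^ 2 + deriv (fun t => logPolar φ r t) θ ^ 2 / u r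
      ≤ -deriv (deriv u) r

theorem IsWarpingPair.gradientBound (hw : IsWarpingPair u φ)
    (hs : ∀ x ∈ strip, 0 ≤ scalarCurvature (warpedMetric u φ) x) : GradientBound u φ := by
  intro r hr θ
  have hx : (![r, θ, 0] : Coord) ∈ strip := hr
  have hu : 0 < u r := hw.u_pos r hr
  have h := hs _ hx
  rw [hw.scalarCurvature_warpedMetric hx] at h
  have h' := mul_nonneg hu.le (nonneg_of_mul_nonneg_right h (by positivity))
  simp only [Matrix.cons_val_zero, Matrix.cons_val_one] at h'
  refine sub_nonneg.1 (h'.trans_eq ?_)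
  field_simp
  ring

end WarpedScalarCurvature

/-! ### Minimal tori and spheres -/

section MeanCurvature

variable {d : Fin 3 → ℝ} {D : ℝ} {F : Coord → ℝ} {G : CoordTensor} {k : Fin 3} {x : Coord}

lemma gradNorm_of_diagonal (hG : G x = Matrix.diagonal d) (hd : ∀ i, 0 < d i) (hD : 0 < D)
    (hF : ∀ a, pd a F x = if k = a then D else 0) : gradNorm G F x = (√(d k))⁻¹ * D := by
  rw [gradNorm, hG, inv_diagonal_of_forall_ne_zero fun i => (hd i).ne', ← Real.sqrt_inv]
  simp only [Matrix.diagonal_apply, hF, Pi.inv_apply, mul_ite, ite_mul, mul_zero, zero_mul,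
    Finset.sum_ite_eq, Finset.mem_univ, if_true]
  rw [mul_assoc, Real.sqrt_mul (inv_pos.2 (hd k)).le, Real.sqrt_mul_self hD.le]

lemma normal_of_diagonal (hG : G x = Matrix.diagonal d) (hd : ∀ i, 0 < d i) (hD : 0 < D)
    (hF : ∀ a, pd a F x = if k = a then D else 0) (i : Fin 3) :
    (∑ j, (G x)⁻¹ i j * pd j F x) / gradNorm G F x = if i = k then (√(d k))⁻¹ else 0 := by
  rw [gradNorm_of_diagonal hG hd hD hF, hG, inv_diagonal_of_forall_ne_zero fun i => (hd i).ne']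
  simp only [Matrix.diagonal_apply, hF, Pi.inv_apply, mul_ite, ite_mul, mul_zero, zero_mul,
    Finset.sum_ite_eq, Finset.mem_univ, if_true]
  rcases eq_or_ne i k with rfl | hik
  · have h := Real.sqrt_pos.2 (hd i)
    rw [if_pos rfl, if_pos rfl, ← Real.sq_sqrt (hd i).le, Real.sqrt_sq h.le]
    field_simp
  · rw [if_neg hik, if_neg hik, zero_div]

theorem meanCurvature_diagonal {d : Coord → Fin 3 → ℝ} {D : Coord → ℝ}
    (hd : ∀ᶠ y in 𝓝 x, ∀ i, 0 < d y i) (hD : ∀ᶠ y in 𝓝 x, 0 < D y)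
    (hF : ∀ y a, pd a F y = if k = a then D y else 0) :
    meanCurvature (fun y => Matrix.diagonal (d y)) F x
      = (√(∏ i, d x i))⁻¹ * pd k (fun y => √((∏ i, d y i) / d y k)) x := by
  have hflux (i) : pd i (fun y => √(Matrix.diagonal (d y)).det *
      ((∑ j, (Matrix.diagonal (d y))⁻¹ i j * pd j F y)
        / gradNorm (fun y => Matrix.diagonal (d y)) F y)) x
      = if i = k then pd k (fun y => √((∏ i, d y i) / d y k)) x else 0 := by
    rw [pd_congr (g := fun y => if i = k then √((∏ i, d y i) / d y k) else 0)]
    · rcases eq_or_ne i k with rfl | hik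
      · simp only [if_true]
      · simp only [if_neg hik, pd_const]
    · filter_upwards [hd, hD] with y hdy hDy
      rw [normal_of_diagonal (G := fun y => Matrix.diagonal (d y)) rfl hdy hDy (hF y),
        Matrix.det_diagonal, mul_ite, mul_zero,
        Real.sqrt_div (Finset.prod_nonneg fun i _ => (hdy i).le), div_eq_mul_inv]
  rw [meanCurvature, Finset.sum_congr rfl fun i _ => hflux i, Matrix.det_diagonal,
    Finset.sum_ite_eq', if_pos (Finset.mem_univ k)]

end MeanCurvature

section RadialCoordinate

variable {r : ℝ}

lemma pi_mul_div_two_mem_Icc (hr : r ∈ Icc (0 : ℝ) 2) : π * r / 2 ∈ Icc 0 π :=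
  ⟨by nlinarith [Real.pi_pos, hr.1], by nlinarith [Real.pi_pos, hr.2]⟩

lemma sin_radius_pos (hr : r ∈ Ioo (0 : ℝ) 2) : 0 < Real.sin (π * r / 2) :=
  Real.sin_pos_of_mem_Ioo ⟨by nlinarith [Real.pi_pos, hr.1], by nlinarith [Real.pi_pos, hr.2]⟩

lemma hasDerivAt_cos_radius (r : ℝ) :
    HasDerivAt (fun s => Real.cos (π * s / 2)) (-(Real.sin (π * r / 2) * (π / 2))) r := by
  have h : HasDerivAt (fun s => π * s / 2) (π / 2) r := by
    simpa using ((hasDerivAt_id r).const_mul π).div_const 2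
  simpa using h.cos

lemma injOn_cos_radius : InjOn (fun r => Real.cos (π * r / 2)) (Icc 0 2) := by
  intro r hr s hs h
  have h' := Real.injOn_cos (pi_mul_div_two_mem_Icc hr) (pi_mul_div_two_mem_Icc hs) h
  have := Real.pi_ne_zero
  field_simp at h'
  exact h'

lemma exists_polarPt_eq_of_apply_two {c : ℝ} (hc : c ∈ Icc (0 : ℝ) 2) {q : S2}
    (hq : (q : EuclideanSpace ℝ (Fin 3)) 2 = Real.cos (π * c / 2)) :
    ∃ θ, polarPt c θ = q := by
  obtain ⟨q, hq1⟩ := q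
  have hnorm : ‖(⟨q 0, q 1⟩ : ℂ)‖ = Real.sin (π * c / 2) := by
    rw [mem_sphere_zero_iff_norm, EuclideanSpace.norm_eq, Real.sqrt_eq_one] at hq1
    simp only [Fin.sum_univ_three, Real.norm_eq_abs, sq_abs] at hq1
    rw [Complex.norm_def, Complex.normSq_mk, Real.sqrt_eq_iff_mul_self_eq
      (add_nonneg (mul_self_nonneg _) (mul_self_nonneg _))
      (Real.sin_nonneg_of_mem_Icc (pi_mul_div_two_mem_Icc hc))]
    dsimp only at hq
    linear_combination hq1 - Real.sin_sq_add_cos_sq (π * c / 2)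
      - (q 2 + Real.cos (π * c / 2)) * hq
  have h0 := Complex.norm_mul_cos_arg ⟨q 0, q 1⟩
  have h1 := Complex.norm_mul_sin_arg ⟨q 0, q 1⟩
  rw [hnorm] at h0 h1
  refine ⟨Complex.arg ⟨q 0, q 1⟩, Subtype.ext ?_⟩
  ext i
  fin_cases i
  exacts [h0, h1, hq.symm]

lemma exists_polarPt_eq (q : S2) : ∃ r θ, polarPt r θ = q := by
  have h1 : |(q : EuclideanSpace ℝ (Fin 3)) 2| ≤ 1 :=
    (PiLp.norm_apply_le _ 2).trans_eq (mem_sphere_zero_iff_norm.1 q.2)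
  set α := Real.arccos ((q : EuclideanSpace ℝ (Fin 3)) 2) with hα
  have hr : π * (2 / π * α) / 2 = α := by
    field_simp
  have hmem : 2 / π * α ∈ Icc (0 : ℝ) 2 := by
    refine ⟨mul_nonneg (by positivity) (Real.arccos_nonneg _), ?_⟩
    rw [div_mul_eq_mul_div, div_le_iff₀ Real.pi_pos]
    exact mul_le_mul_of_nonneg_left (Real.arccos_le_pi _) zero_le_two
  obtain ⟨θ, hθ⟩ := exists_polarPt_eq_of_apply_two hmem (q := q)
    (by rw [hr, hα, Real.cos_arccos (abs_le.1 h1).1 (abs_le.1 h1).2])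
  exact ⟨_, θ, hθ⟩

end RadialCoordinate

lemma mfderiv_ne_zero_of_hasDerivAt {f : M → ℝ} {y : ℝ → Coord} {t D : ℝ} (hy : ContDiff ℝ ∞ y)
    (hf : MDifferentiableAt modelM 𝓘(ℝ, ℝ) f (coordMap (y t)))
    (hD : HasDerivAt (fun s => f (coordMap (y s))) D t) (hD0 : D ≠ 0) :
    mfderiv modelM 𝓘(ℝ, ℝ) f (coordMap (y t)) ≠ 0 := by
  intro h0
  have hc : MDifferentiableAt 𝓘(ℝ, ℝ) modelM (fun s => coordMap (y s)) t :=
    (contMDiff_coordMap hy).mdifferentiableAt (by simp)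
  have hcomp := mfderiv_comp t (g := f) (f := fun s => coordMap (y s)) hf hc
  rw [h0] at hcomp
  have hzero : (ContinuousLinearMap.toSpanSingleton ℝ D : ℝ →L[ℝ] ℝ) = 0 :=
    hD.hasFDerivAt.hasMFDerivAt.mfderiv.symm.trans (hcomp.trans (ContinuousLinearMap.zero_comp _))
  exact hD0 (by simpa using congrArg (fun L : ℝ →L[ℝ] ℝ => L 1) hzero)

section MinimalSurfaces

variable {u : ℝ → ℝ} {φ : S2 → ℝ}

lemma IsWarpingPair.diag_pos (hw : IsWarpingPair u φ) {x : Coord} (hx : x ∈ strip) (i : Fin 3) :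
    0 < (![(φ (polarPt (x 0) (x 1)) ^ 2)⁻¹, (φ (polarPt (x 0) (x 1)) ^ 2)⁻¹ * u (x 0) ^ 2,
      φ (polarPt (x 0) (x 1)) ^ 2] : Fin 3 → ℝ) i := by
  have hu := hw.u_pos _ hx
  have hφ := hw.φ_pos (polarPt (x 0) (x 1))
  fin_cases i <;> dsimp <;> positivity

/-- The third coordinate of the sphere factor. -/
def height (p : M) : ℝ := (p.1 : EuclideanSpace ℝ (Fin 3)) 2

lemma contMDiff_height : ContMDiff modelM 𝓘(ℝ, ℝ) ∞ height := by
  have h : ContDiff ℝ ∞ (fun v : EuclideanSpace ℝ (Fin 3) => v 2) := by fun_prop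
  exact (h.contMDiff.comp contMDiff_coe_sphere).comp contMDiff_fst

lemma height_coordMap (x : Coord) : height (coordMap x) = Real.cos (π * x 0 / 2) := by
  simp [height, coordMap, polarPt]

/-- The torus `r = c`, for `0 < c < 2`. -/
def radialTorus (c : ℝ) : Set M := {p | height p = Real.cos (π * c / 2)}

lemma exists_coordMap_eq_of_mem_radialTorus {c : ℝ} (hc : c ∈ Ioo (0 : ℝ) 2) {p : M}
    (hp : p ∈ radialTorus c) : ∃ θ ξ, coordMap ![c, θ, ξ] = p := by
  obtain ⟨θ, hθ⟩ := exists_polarPt_eq_of_apply_two (Ioo_subset_Icc_self hc) hp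
  exact ⟨θ, Complex.arg p.2, Prod.ext hθ (Circle.exp_arg p.2)⟩

lemma isDefiningFunction_radialTorus {c : ℝ} (hc : c ∈ Ioo (0 : ℝ) 2) :
    IsDefiningFunction (radialTorus c) univ (fun q => Real.cos (π * c / 2) - height q) := by
  have hs : ContMDiff modelM 𝓘(ℝ, ℝ) ∞ (fun q => Real.cos (π * c / 2) - height q) :=
    contMDiff_const.sub contMDiff_height
  refine ⟨isOpen_univ, hs.contMDiffOn, ?_, ?_⟩
  swap
  · ext q
    rw [inter_univ, sep_univ, radialTorus, mem_ofPred_eq, mem_ofPred_eq, sub_eq_zero, eq_comm]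
  rintro q ⟨hq, -⟩
  obtain ⟨θ, ξ, rfl⟩ := exists_coordMap_eq_of_mem_radialTorus hc hq
  refine mfderiv_ne_zero_of_hasDerivAt (y := fun t => ![t, θ, ξ]) (t := c)
    (D := - -(Real.sin (π * c / 2) * (π / 2))) ?_ (hs.mdifferentiableAt (by simp)) ?_ ?_
  · exact contDiff_pi.2 fun i => by fin_cases i <;> dsimp <;> fun_prop
  · simp only [height_coordMap]
    exact (hasDerivAt_cos_radius c).const_sub _
  · have := sin_radius_pos hc
    rw [neg_neg]
    positivity

lemma meanCurvature_sub_height (hw : IsWarpingPair u φ) (C : ℝ) {x : Coord} (hx : x ∈ strip)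
    (hu : deriv u (x 0) = 0) :
    meanCurvature (warpedMetric u φ) ((fun q => C - height q) ∘ coordMap) x = 0 := by
  have hF (y : Coord) (a) : pd a ((fun q => C - height q) ∘ coordMap) y
      = if 0 = a then Real.sin (π * y 0 / 2) * (π / 2) else 0 := by
    have h := (hasDerivAt_cos_radius (y 0)).const_sub C
    rw [show (fun q => C - height q) ∘ coordMap = fun y : Coord => C - Real.cos (π * y 0 / 2) from
      funext fun y => by simp only [Function.comp_apply, height_coordMap],
      pd_comp_coord (w := fun s => C - Real.cos (π * s / 2)) h.differentiableAt, h.deriv, neg_neg]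
  have hstrip : ∀ᶠ y in 𝓝 x, y ∈ strip := isOpen_strip.mem_nhds hx
  unfold warpedMetric
  rw [meanCurvature_diagonal (k := 0) (hstrip.mono fun y hy => hw.diag_pos hy)
    (hstrip.mono fun y hy => mul_pos (sin_radius_pos hy) Real.pi_div_two_pos) hF,
    pd_congr (g := fun y => u (y 0)), pd_comp_coord (hw.differentiableAt hx),
    hu, ite_self, mul_zero]
  filter_upwards [hstrip] with y hy
  have hφ := hw.φ_pos (polarPt (y 0) (y 1))
  refine (congrArg _ ?_).trans (Real.sqrt_sq (hw.u_pos _ hy).le)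
  simp only [Fin.prod_univ_three, Matrix.cons_val]
  field_simp

theorem isClosedMinimalSurface_radialTorus (hw : IsWarpingPair u φ) {c : ℝ}
    (hc : c ∈ Ioo (0 : ℝ) 2) (hu : deriv u c = 0) :
    IsClosedMinimalSurface (warpedMetric u φ) (radialTorus c) where
  isClosed := isClosed_eq contMDiff_height.continuous continuous_const
  nonempty := ⟨coordMap ![c, 0, 0], height_coordMap _⟩
  minimal p _ := by
    refine ⟨univ, _, mem_univ _, isDefiningFunction_radialTorus hc, ?_⟩
    rintro x hx ⟨hxS, -⟩
    have hxc : x 0 = c := injOn_cos_radius (Ioo_subset_Icc_self hx) (Ioo_subset_Icc_self hc)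
      ((height_coordMap x).symm.trans hxS)
    exact meanCurvature_sub_height hw _ hx (hxc ▸ hu)

/-- The sphere `ξ = 0`. -/
def zeroSphere : Set M := {p | p.2 = 1}

/-- The sine of the angle `ξ`. -/
def fiberSin (p : M) : ℝ := (p.2 : ℂ).im

lemma contMDiff_fiberSin : ContMDiff modelM 𝓘(ℝ, ℝ) ∞ fiberSin := by
  have : Fact (Module.finrank ℝ ℂ = 1 + 1) := ⟨by simp⟩
  have hcoe : ContMDiff (M := Circle) (𝓡 1) 𝓘(ℝ, ℂ) ∞ (fun z : Circle => (z : ℂ)) :=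
    contMDiff_coe_sphere (E := ℂ) (n := 1)
  have him : ContDiff ℝ ∞ (fun z : ℂ => z.im) := Complex.imCLM.contDiff
  exact (him.contMDiff.comp hcoe).comp contMDiff_snd

lemma fiberSin_coordMap (x : Coord) : fiberSin (coordMap x) = Real.sin (x 2) := by
  simp [fiberSin, coordMap, Circle.coe_exp, Complex.exp_ofReal_mul_I_im]

lemma circle_eq_one_iff (z : Circle) : z = 1 ↔ 0 < (z : ℂ).re ∧ (z : ℂ).im = 0 := by
  refine ⟨by rintro rfl; simp, fun ⟨_, him⟩ => ?_⟩
  have h1 : (z : ℂ).re * (z : ℂ).re = 1 := by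
    simpa [Complex.normSq_apply, him] using Circle.normSq_coe z
  ext
  exact Complex.ext (by rw [Circle.coe_one, Complex.one_re]; nlinarith) him

lemma isDefiningFunction_zeroSphere :
    IsDefiningFunction zeroSphere {q | 0 < (q.2 : ℂ).re} fiberSin where
  isOpen := isOpen_lt continuous_const
    (Complex.continuous_re.comp (continuous_subtype_val.comp continuous_snd))
  smooth := contMDiff_fiberSin.contMDiffOn
  submersion := by
    rintro ⟨q, z⟩ ⟨rfl : z = 1, -⟩
    obtain ⟨r, θ, rfl⟩ := exists_polarPt_eq q
    have hq : coordMap ![r, θ, 0] = (polarPt r θ, 1) := by simp [coordMap]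
    rw [← hq]
    refine mfderiv_ne_zero_of_hasDerivAt (y := fun t => ![r, θ, t]) (t := 0) ?_
      (contMDiff_fiberSin.mdifferentiableAt (by simp))
      (by simp only [fiberSin_coordMap]; exact Real.hasDerivAt_sin 0) (by simp)
    exact contDiff_pi.2 fun i => by fin_cases i <;> dsimp <;> fun_prop
  eq_zeroSet := by
    ext ⟨q, z⟩
    have := circle_eq_one_iff z
    simp only [zeroSphere, fiberSin, mem_inter_iff, mem_ofPred_eq]
    tauto

lemma meanCurvature_fiberSin (hw : IsWarpingPair u φ) {x : Coord} (hx : x ∈ strip)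
    (hcos : 0 < Real.cos (x 2)) :
    meanCurvature (warpedMetric u φ) (fiberSin ∘ coordMap) x = 0 := by
  have hF (y : Coord) (a) :
      pd a (fiberSin ∘ coordMap) y = if 2 = a then Real.cos (y 2) else 0 := by
    rw [show fiberSin ∘ coordMap = fun y : Coord => Real.sin (y 2) from funext fiberSin_coordMap,
      pd_comp_coord Real.differentiableAt_sin, Real.deriv_sin]
  have hpos : ∀ᶠ y : Coord in 𝓝 x, 0 < Real.cos (y 2) :=
    (isOpen_lt continuous_const (by fun_prop)).mem_nhds hcos
  unfold warpedMetric
  rw [meanCurvature_diagonal (k := 2)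
    (Filter.mem_of_superset (isOpen_strip.mem_nhds hx) fun y hy => hw.diag_pos hy) hpos hF,
    pd_eq_zero_of_forall_update fun t => by simp [Fin.prod_univ_three], mul_zero]

theorem isClosedMinimalSurface_zeroSphere (hw : IsWarpingPair u φ) :
    IsClosedMinimalSurface (warpedMetric u φ) zeroSphere where
  isClosed := isClosed_eq continuous_snd continuous_const
  nonempty := ⟨(polarPt 0 0, 1), rfl⟩
  minimal p hp := by
    refine ⟨_, fiberSin, ((circle_eq_one_iff p.2).1 hp).1, isDefiningFunction_zeroSphere, ?_⟩
    rintro x hx ⟨-, hxW⟩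
    refine meanCurvature_fiberSin hw hx ?_
    simpa [coordMap, Circle.coe_exp, Complex.exp_ofReal_mul_I_re] using hxW

end MinimalSurfaces

section AreaVolume

variable {u : ℝ → ℝ} {φ : S2 → ℝ}

theorem area_le_of_chart {G : CoordTensor} {S : Set M} {U B : Set (Fin 2 → ℝ)}
    {Y : (Fin 2 → ℝ) → Coord} {K : ℝ} (hU : IsOpen U) (hY : ContDiffOn ℝ ∞ Y U)
    (hm : MapsTo Y U strip) (hB : B ⊆ U) (hBm : MeasurableSet B)
    (hS : (coordMap ∘ Y) '' B = S ∩ coordMap '' strip) (hK : ∀ s ∈ B, areaDensity G Y s ≤ K) :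
    area G S ≤ ENNReal.ofReal K * volume B := by
  have hP : IsParametrization S (fun _ => U) (fun _ => Y) (fun n => if n = 0 then B else ∅) := by
    refine ⟨fun _ => hU, fun _ => hY, fun _ => hm, fun n => ?_, fun n => ?_, ?_⟩
    · split_ifs
      exacts [hB, empty_subset _]
    · split_ifs
      exacts [hBm, MeasurableSet.empty]
    · refine hS ▸ (iUnion_subset fun n => ?_).antisymm (subset_iUnion_of_subset 0 (by simp))
      exact image_mono (by split_ifs <;> simp)
  calc area G S ≤ ∑' n, ∫⁻ s in (if n = 0 then B else ∅), ENNReal.ofReal (areaDensity G Y s) :=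
        iInf_le_of_le _ (iInf_le_of_le _ (iInf_le_of_le _ (iInf_le _ hP)))
    _ = ∫⁻ s in B, ENNReal.ofReal (areaDensity G Y s) := by
        rw [tsum_eq_single 0 fun n hn => by simp [hn], if_pos rfl]
    _ ≤ ∫⁻ _ in B, ENNReal.ofReal K :=
        setLIntegral_mono' hBm fun s hs => ENNReal.ofReal_le_ofReal (hK s hs)
    _ = ENNReal.ofReal K * volume B := setLIntegral_const _ _

/-- The coordinate plane `xᵢ = c`, parametrized by the two other coordinates in order. -/
def coordPlane (i : Fin 3) (c : ℝ) (s : Fin 2 → ℝ) : Coord := i.insertNth (α := fun _ => ℝ) c s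

lemma coordPlane_apply_same (i : Fin 3) (c : ℝ) (s : Fin 2 → ℝ) : coordPlane i c s i = c :=
  Fin.insertNth_apply_same ..

lemma coordPlane_apply_succAbove (i : Fin 3) (c : ℝ) (s : Fin 2 → ℝ) (j : Fin 2) :
    coordPlane i c s (i.succAbove j) = s j :=
  Fin.insertNth_apply_succAbove ..

lemma contDiff_coordPlane (i : Fin 3) (c : ℝ) :
    ContDiff ℝ ∞ (coordPlane i c) := by
  refine contDiff_pi.2 ((Fin.forall_iff_succAbove i).2 ⟨?_, fun j => ?_⟩)
  · simpa only [coordPlane_apply_same] using contDiff_const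
  · simpa only [coordPlane_apply_succAbove] using contDiff_apply ℝ ℝ j

lemma fderiv_coordPlane_single (i : Fin 3) (c : ℝ) (s : Fin 2 → ℝ) (α : Fin 2) :
    fderiv ℝ (coordPlane i c) s (Pi.single α 1)
      = Pi.single (i.succAbove α) 1 := by
  have hd : Differentiable ℝ (coordPlane i c) :=
    (contDiff_coordPlane i c).differentiable (by simp)
  have happ (j : Fin 3) : fderiv ℝ (coordPlane i c) s (Pi.single α 1) j
      = fderiv ℝ (fun t => coordPlane i c t j) s (Pi.single α 1) := by
    rw [fderiv_apply (hd s)]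
    rfl
  refine funext ((Fin.forall_iff_succAbove i).2 ⟨?_, fun j => ?_⟩)
  · rw [happ]
    simp [coordPlane_apply_same]
  · rw [happ]
    simp only [coordPlane_apply_succAbove]
    rw [(hasFDerivAt_apply j s).fderiv]
    simp [Pi.single_apply]

lemma areaDensity_coordPlane {d : Coord → Fin 3 → ℝ} (i : Fin 3) (c : ℝ) (s : Fin 2 → ℝ) :
    areaDensity (fun x => Matrix.diagonal (d x)) (coordPlane i c) s
      = √(d (coordPlane i c s) (i.succAbove 0) * d (coordPlane i c s) (i.succAbove 1)) := by
  simp only [areaDensity, fderiv_coordPlane_single, Matrix.det_fin_two, Matrix.of_apply]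
  simp

lemma areaDensity_radialTorus (hw : IsWarpingPair u φ) {c : ℝ} (hc : c ∈ Ioo (0 : ℝ) 2)
    (s : Fin 2 → ℝ) : areaDensity (warpedMetric u φ) (coordPlane 0 c) s = u c := by
  have hφ := hw.φ_pos (polarPt c (s 0))
  refine (areaDensity_coordPlane 0 c s).trans
    ((congrArg _ ?_).trans (Real.sqrt_sq (hw.u_pos c hc).le))
  change (φ (polarPt c (s 0)) ^ 2)⁻¹ * u c ^ 2 * φ (polarPt c (s 0)) ^ 2 = _
  field_simp

lemma areaDensity_zeroSphere (hw : IsWarpingPair u φ) {s : Fin 2 → ℝ}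
    (hs : s 0 ∈ Ioo (0 : ℝ) 2) : areaDensity (warpedMetric u φ) (coordPlane 2 0) s
      = u (s 0) / φ (polarPt (s 0) (s 1)) ^ 2 := by
  have hφ := hw.φ_pos (polarPt (s 0) (s 1))
  have hu := hw.u_pos _ hs
  refine (areaDensity_coordPlane 2 0 s).trans
    ((congrArg _ ?_).trans (Real.sqrt_sq (by positivity)))
  change (φ (polarPt (s 0) (s 1)) ^ 2)⁻¹ * ((φ (polarPt (s 0) (s 1)) ^ 2)⁻¹ * u (s 0) ^ 2) = _
  field_simp

lemma exists_mem_Icc_circleExp_eq (ξ : ℝ) :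
    ∃ ξ' ∈ Icc 0 (2 * π), Circle.exp ξ' = Circle.exp ξ := by
  obtain ⟨n, hn⟩ := exists_add_int_mul_two_pi_mem_Icc ξ
  exact ⟨_, hn, Circle.exp_eq_exp.2 ⟨n, rfl⟩⟩

lemma exists_mem_Icc_polarPt_eq (r θ : ℝ) : ∃ θ' ∈ Icc 0 (2 * π), polarPt r θ' = polarPt r θ := by
  obtain ⟨n, hn⟩ := exists_add_int_mul_two_pi_mem_Icc θ
  exact ⟨_, hn, polarPt_add_int_mul_two_pi r θ n⟩

lemma image_coordMap_insertNth_zero {c : ℝ} (hc : c ∈ Ioo (0 : ℝ) 2) :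
    (coordMap ∘ coordPlane 0 c) '' (Icc (fun _ => 0) (fun _ => 2 * π) : Set (Fin 2 → ℝ))
      = radialTorus c ∩ coordMap '' strip := by
  refine Subset.antisymm ?_ ?_
  · rintro _ ⟨s, -, rfl⟩
    exact ⟨height_coordMap _, _, hc, rfl⟩
  · rintro p ⟨hp, -⟩
    obtain ⟨θ, ξ, rfl⟩ := exists_coordMap_eq_of_mem_radialTorus hc hp
    obtain ⟨θ', hθ, hθ_eq⟩ := exists_mem_Icc_polarPt_eq c θ
    obtain ⟨ξ', hξ, hξ_eq⟩ := exists_mem_Icc_circleExp_eq ξ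
    exact ⟨![θ', ξ'], ⟨Fin.forall_fin_two.2 ⟨hθ.1, hξ.1⟩, Fin.forall_fin_two.2 ⟨hθ.2, hξ.2⟩⟩,
      Prod.ext hθ_eq hξ_eq⟩

lemma image_coordMap_insertNth_two :
    (coordMap ∘ coordPlane 2 0) '' {s : Fin 2 → ℝ | s 0 ∈ Ioo 0 2 ∧ s 1 ∈ Icc 0 (2 * π)}
      = zeroSphere ∩ coordMap '' strip := by
  refine Subset.antisymm ?_ ?_
  · rintro _ ⟨s, hs, rfl⟩
    exact ⟨Circle.exp_zero, _, hs.1, rfl⟩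
  · rintro _ ⟨hp, x, hx, rfl⟩
    obtain ⟨θ', hθ, hθ_eq⟩ := exists_mem_Icc_polarPt_eq (x 0) (x 1)
    exact ⟨![x 0, θ'], ⟨hx, hθ⟩, Prod.ext hθ_eq (Circle.exp_zero.trans hp.symm)⟩

theorem area_radialTorus_le (hw : IsWarpingPair u φ) {c : ℝ} (hc : c ∈ Ioo (0 : ℝ) 2) :
    area (warpedMetric u φ) (radialTorus c) ≤ ENNReal.ofReal (4 * π ^ 2 * u c) := by
  refine (area_le_of_chart isOpen_univ (contDiff_coordPlane 0 c).contDiffOn (fun s _ => hc)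
    (subset_univ _) measurableSet_Icc (image_coordMap_insertNth_zero hc)
    fun s _ => (areaDensity_radialTorus hw hc s).le).trans_eq ?_
  rw [Real.volume_Icc_pi, Fin.prod_univ_two, sub_zero, ← ENNReal.ofReal_mul (by positivity),
    ← ENNReal.ofReal_mul (hw.u_pos c hc).le]
  ring_nf

theorem area_zeroSphere_le (hw : IsWarpingPair u φ) {K : ℝ} (hK : 0 ≤ K)
    (h : ∀ r ∈ Ioo (0 : ℝ) 2, ∀ θ, u r / φ (polarPt r θ) ^ 2 ≤ K) :
    area (warpedMetric u φ) zeroSphere ≤ ENNReal.ofReal (4 * π * K) := by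
  have hBm : MeasurableSet {s : Fin 2 → ℝ | s 0 ∈ Ioo 0 2 ∧ s 1 ∈ Icc 0 (2 * π)} :=
    (measurableSet_Ioo.preimage (measurable_pi_apply 0)).inter
      (measurableSet_Icc.preimage (measurable_pi_apply 1))
  have hsub : {s : Fin 2 → ℝ | s 0 ∈ Ioo 0 2 ∧ s 1 ∈ Icc 0 (2 * π)}
      ⊆ Icc ![0, 0] ![2, 2 * π] := fun s hs =>
    ⟨Fin.forall_fin_two.2 ⟨hs.1.1.le, hs.2.1⟩, Fin.forall_fin_two.2 ⟨hs.1.2.le, hs.2.2⟩⟩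
  refine (area_le_of_chart (isOpen_Ioo.preimage (continuous_apply 0))
    (contDiff_coordPlane 2 0).contDiffOn (fun s hs => hs) (fun s hs => hs.1) hBm
    image_coordMap_insertNth_two fun s hs => (areaDensity_zeroSphere hw hs.1).trans_le
      (h _ hs.1 _)).trans ((mul_le_mul_right (measure_mono hsub) _).trans_eq ?_)
  rw [Real.volume_Icc_pi, Fin.prod_univ_two, ← ENNReal.ofReal_mul (by norm_num),
    ← ENNReal.ofReal_mul hK]
  norm_num
  ring_nf

lemma IsWarpingPair.sqrt_det_warpedMetric (hw : IsWarpingPair u φ) {x : Coord} (hx : x ∈ strip) :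
    √(warpedMetric u φ x).det = u (x 0) / φ (polarPt (x 0) (x 1)) := by
  have hφ := hw.φ_pos (polarPt (x 0) (x 1))
  have hu := hw.u_pos _ hx
  rw [warpedMetric, Matrix.det_diagonal, Fin.prod_univ_three]
  refine (congrArg _ ?_).trans (Real.sqrt_sq (by positivity))
  simp only [Matrix.cons_val]
  field_simp

lemma measurableSet_box : MeasurableSet box :=
  (measurableSet_Ioo.preimage (measurable_pi_apply 0)).inter
    ((measurableSet_Ioo.preimage (measurable_pi_apply 1)).inter
      (measurableSet_Ioo.preimage (measurable_pi_apply 2)))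

theorem le_vol_warpedMetric (hw : IsWarpingPair u φ) {m : ℝ} (hm : 0 ≤ m)
    (h : ∀ r ∈ Ioo (1 / 2 : ℝ) (3 / 2), ∀ θ, m ≤ u r / φ (polarPt r θ)) :
    ENNReal.ofReal (4 * π ^ 2 * m) ≤ vol (warpedMetric u φ) := by
  rw [vol, volMeasure, withDensity_apply _ MeasurableSet.univ, Measure.restrict_univ]
  set A : Set Coord := univ.pi fun i => Ioo ((![1 / 2, 0, 0] : Coord) i)
    ((![3 / 2, 2 * π, 2 * π] : Coord) i) with hA
  have hmem (x) (hx : x ∈ A) : x 0 ∈ Ioo (1 / 2 : ℝ) (3 / 2) ∧ x ∈ box := by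
    have h0 : x 0 ∈ Ioo (1 / 2 : ℝ) (3 / 2) := hx 0 trivial
    exact ⟨h0, ⟨by linarith [h0.1], by linarith [h0.2]⟩, hx 1 trivial, hx 2 trivial⟩
  calc ENNReal.ofReal (4 * π ^ 2 * m) = ∫⁻ _ in A, ENNReal.ofReal m := by
        rw [setLIntegral_const, hA, Real.volume_pi_Ioo, Fin.prod_univ_three]
        simp only [Matrix.cons_val]
        rw [← ENNReal.ofReal_mul (by norm_num), ← ENNReal.ofReal_mul (by norm_num; positivity),
          ← ENNReal.ofReal_mul hm]
        ring_nf
    _ ≤ ∫⁻ x in A, ENNReal.ofReal (√(warpedMetric u φ x).det) := by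
        refine setLIntegral_mono' (MeasurableSet.univ_pi fun _ => measurableSet_Ioo) fun x hx =>
          ENNReal.ofReal_le_ofReal ?_
        obtain ⟨h0, hbox⟩ := hmem x hx
        rw [hw.sqrt_det_warpedMetric hbox.1]
        exact h _ h0 _
    _ ≤ ∫⁻ x in box, ENNReal.ofReal (√(warpedMetric u φ x).det) :=
        lintegral_mono_set fun x hx => (hmem x hx).2

end AreaVolume

/-! ### A priori estimates -/

lemma chord_le_of_concaveOn {s : Set ℝ} {f : ℝ → ℝ} (hf : ConcaveOn ℝ s f) {a b x : ℝ}
    (ha : a ∈ s) (hb : b ∈ s) (hx : x ∈ Icc a b) :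
    (b - x) * f a + (x - a) * f b ≤ (b - a) * f x := by
  rcases (hx.1.trans hx.2).eq_or_lt with rfl | hab
  · obtain rfl := le_antisymm hx.1 hx.2
    simp
  have hba : 0 < b - a := sub_pos.2 hab
  have h := hf.2 ha hb (div_nonneg (sub_nonneg.2 hx.2) hba.le)
    (div_nonneg (sub_nonneg.2 hx.1) hba.le) (by field_simp; ring)
  have hcomb : (b - x) / (b - a) * a + (x - a) / (b - a) * b = x := by
    field_simp
    ring
  simp only [smul_eq_mul, hcomb] at h
  calc (b - x) * f a + (x - a) * f b
      = (b - a) * ((b - x) / (b - a) * f a + (x - a) / (b - a) * f b) := by field_simp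
    _ ≤ (b - a) * f x := mul_le_mul_of_nonneg_left h hba.le

theorem mul_le_sq_mul_of_concaveOn {f : ℝ → ℝ} {a b c x : ℝ} (hf : ConcaveOn ℝ (Icc a b) f)
    (ha : 0 ≤ f a) (hb : 0 ≤ f b) (hc : c ∈ Icc a b) (hx : x ∈ Icc a b) :
    f c * ((x - a) * (b - x)) ≤ (b - a) ^ 2 * f x := by
  have hab := hx.1.trans hx.2
  have ha' := left_mem_Icc.2 hab
  have hb' := right_mem_Icc.2 hab
  have hxa := sub_nonneg.2 hx.1
  have hxb := sub_nonneg.2 hx.2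
  have hfx : 0 ≤ f x := by
    have := hf.min_le_of_mem_Icc ha' hb' hx
    exact (le_min ha hb).trans this
  rcases le_total x c with hxc | hcx
  · have h : (x - a) * f c ≤ (b - a) * f x := by
      nlinarith [chord_le_of_concaveOn hf ha' hc ⟨hx.1, hxc⟩, hc.2]
    nlinarith [mul_le_mul_of_nonneg_right h hxb, mul_nonneg (mul_nonneg hxa hfx) (hxa.trans
      (sub_le_sub_right hx.2 a))]
  · have h : (b - x) * f c ≤ (b - a) * f x := by
      nlinarith [chord_le_of_concaveOn hf hc hb' ⟨hcx, hx.2⟩, hc.1]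
    nlinarith [mul_le_mul_of_nonneg_right h hxa, mul_nonneg (mul_nonneg hxb hfx) (hxa.trans
      (sub_le_sub_right hx.2 a))]

section ProfileFunction

variable {u : ℝ → ℝ} {φ : S2 → ℝ} {r s : ℝ}

lemma derivWithin_eq_deriv (hr : r ∈ Ioo (0 : ℝ) 2) : derivWithin u (Icc 0 2) r = deriv u r :=
  derivWithin_of_mem_nhds (Icc_mem_nhds hr.1 hr.2)

lemma IsWarpingPair.deriv_deriv_nonpos (hw : IsWarpingPair u φ) (hg : GradientBound u φ)
    (hr : r ∈ Ioo (0 : ℝ) 2) : deriv (deriv u) r ≤ 0 := by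
  have hu := hw.u_pos r hr
  have h : 0 ≤ u r * deriv (fun s => logPolar φ s 0) r ^ 2
      + deriv (fun t => logPolar φ r t) 0 ^ 2 / u r := by positivity
  linarith [hg r hr 0]

lemma IsWarpingPair.antitoneOn_derivWithin (hw : IsWarpingPair u φ) (hg : GradientBound u φ) :
    AntitoneOn (derivWithin u (Icc 0 2)) (Icc 0 2) := by
  have heq (r : ℝ) (hr : r ∈ Ioo (0 : ℝ) 2) : derivWithin u (Icc 0 2) =ᶠ[𝓝 r] deriv u := by
    filter_upwards [isOpen_Ioo.mem_nhds hr] with s hs using derivWithin_eq_deriv hs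
  refine antitoneOn_of_deriv_nonpos (convex_Icc 0 2)
    (hw.u_smooth.continuousOn_derivWithin (uniqueDiffOn_Icc two_pos) (by simp)) ?_ ?_ <;>
    rw [interior_Icc] <;> intro r hr
  · exact ((heq r hr).differentiableAt_iff.2
      (hw.differentiableAt_deriv hr)).differentiableWithinAt
  · rw [(heq r hr).deriv_eq]
    exact hw.deriv_deriv_nonpos hg hr

lemma IsWarpingPair.abs_derivWithin_le (hw : IsWarpingPair u φ) (hg : GradientBound u φ)
    (hr : r ∈ Icc (0 : ℝ) 2) : |derivWithin u (Icc 0 2) r| ≤ 1 :=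
  abs_le.2 ⟨hw.deriv_two ▸ hw.antitoneOn_derivWithin hg hr (right_mem_Icc.2 zero_le_two) hr.2,
    hw.deriv_zero ▸ hw.antitoneOn_derivWithin hg (left_mem_Icc.2 zero_le_two) hr hr.1⟩

lemma IsWarpingPair.abs_deriv_le (hw : IsWarpingPair u φ) (hg : GradientBound u φ)
    (hr : r ∈ Ioo (0 : ℝ) 2) : |deriv u r| ≤ 1 :=
  derivWithin_eq_deriv (u := u) hr ▸ hw.abs_derivWithin_le hg (Ioo_subset_Icc_self hr)

lemma IsWarpingPair.abs_sub_le (hw : IsWarpingPair u φ) (hg : GradientBound u φ)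
    (hr : r ∈ Icc (0 : ℝ) 2) (hs : s ∈ Icc (0 : ℝ) 2) : |u r - u s| ≤ |r - s| := by
  simpa using (convex_Icc (0 : ℝ) 2).norm_image_sub_le_of_norm_derivWithin_le
    (hw.u_smooth.differentiableOn (by simp)) (fun x hx => hw.abs_derivWithin_le hg hx) hs hr

lemma IsWarpingPair.u_nonneg (hw : IsWarpingPair u φ) (hr : r ∈ Icc (0 : ℝ) 2) : 0 ≤ u r := by
  rcases hr.1.eq_or_lt with rfl | h0
  · exact hw.u_zero.ge
  rcases hr.2.eq_or_lt with rfl | h2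
  · exact hw.u_two.ge
  exact (hw.u_pos r ⟨h0, h2⟩).le

lemma IsWarpingPair.u_le_min (hw : IsWarpingPair u φ) (hg : GradientBound u φ)
    (hr : r ∈ Icc (0 : ℝ) 2) : u r ≤ min r (2 - r) := by
  have h0 := hw.abs_sub_le hg hr (left_mem_Icc.2 zero_le_two)
  have h2 := hw.abs_sub_le hg hr (right_mem_Icc.2 zero_le_two)
  rw [hw.u_zero, sub_zero, sub_zero, abs_of_nonneg hr.1] at h0
  rw [hw.u_two, sub_zero, abs_sub_comm, abs_of_nonneg (sub_nonneg.2 hr.2)] at h2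
  exact le_min ((le_abs_self _).trans h0) ((le_abs_self _).trans h2)

lemma IsWarpingPair.concaveOn (hw : IsWarpingPair u φ) (hg : GradientBound u φ) :
    ConcaveOn ℝ (Icc 0 2) u := by
  refine AntitoneOn.concaveOn_of_deriv (convex_Icc 0 2) hw.u_smooth.continuousOn ?_ ?_ <;>
    rw [interior_Icc]
  · exact fun r hr => (hw.differentiableAt hr).differentiableWithinAt
  · intro r hr s hs hrs
    rw [← derivWithin_eq_deriv hr, ← derivWithin_eq_deriv hs]
    exact hw.antitoneOn_derivWithin hg (Ioo_subset_Icc_self hr) (Ioo_subset_Icc_self hs) hrs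

lemma IsWarpingPair.exists_le_of_le_minA (hw : IsWarpingPair u φ) {A₀ : ℝ}
    (hA : ENNReal.ofReal A₀ ≤ minA (warpedMetric u φ)) :
    ∃ c ∈ Ioo (0 : ℝ) 2, A₀ ≤ 4 * π ^ 2 * u c := by
  obtain ⟨c, hc, hdc⟩ := exists_deriv_eq_zero two_pos hw.u_smooth.continuousOn
    (hw.u_zero.trans hw.u_two.symm)
  have huc := hw.u_pos c hc
  refine ⟨c, hc, (ENNReal.ofReal_le_ofReal_iff (by positivity)).1 ?_⟩
  exact hA.trans ((iInf₂_le _ (isClosedMinimalSurface_radialTorus hw hc hdc)).trans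
    (area_radialTorus_le hw hc))

theorem IsWarpingPair.mul_le_of_le_minA (hw : IsWarpingPair u φ) (hg : GradientBound u φ) {A₀ : ℝ}
    (hA : ENNReal.ofReal A₀ ≤ minA (warpedMetric u φ)) (hr : r ∈ Icc (0 : ℝ) 2) :
    A₀ / (16 * π ^ 2) * (r * (2 - r)) ≤ u r := by
  obtain ⟨c, hc, hAc⟩ := hw.exists_le_of_le_minA hA
  have hconc := mul_le_sq_mul_of_concaveOn (hw.concaveOn hg) hw.u_zero.ge hw.u_two.ge
    (Ioo_subset_Icc_self hc) hr
  rw [sub_zero, sub_zero] at hconc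
  rw [div_mul_eq_mul_div, div_le_iff₀ (by positivity)]
  calc A₀ * (r * (2 - r)) ≤ 4 * π ^ 2 * u c * (r * (2 - r)) :=
        mul_le_mul_of_nonneg_right hAc (mul_nonneg hr.1 (sub_nonneg.2 hr.2))
    _ = 4 * π ^ 2 * (u c * (r * (2 - r))) := mul_assoc _ _ _
    _ ≤ 4 * π ^ 2 * (2 ^ 2 * u r) := mul_le_mul_of_nonneg_left hconc (by positivity)
    _ = u r * (16 * π ^ 2) := by ring

end ProfileFunction

section LogRatio

variable {r : ℝ}

/-- The primitive `log (r / (2 - r))` of `2 / (r (2 - r))`, in which the oscillation of `log φ`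
towards the poles is measured. -/
def logRatio (r : ℝ) : ℝ := Real.log r - Real.log (2 - r)

lemma hasDerivAt_logRatio (hr : r ∈ Ioo (0 : ℝ) 2) :
    HasDerivAt logRatio (2 / (r * (2 - r))) r := by
  have h0 : r ≠ 0 := hr.1.ne'
  have h2 : 2 - r ≠ 0 := (sub_pos.2 hr.2).ne'
  refine ((Real.hasDerivAt_log h0).sub (((hasDerivAt_id r).const_sub 2).log h2)).congr_deriv ?_
  rw [id_eq]
  field_simp
  ring

lemma logRatio_one : logRatio 1 = 0 := by norm_num [logRatio]

lemma monotoneOn_logRatio : MonotoneOn logRatio (Ioo 0 2) := fun _ hs _ hr h =>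
  sub_le_sub (Real.log_le_log hs.1 h) (Real.log_le_log (sub_pos.2 hr.2) (sub_le_sub_left h 2))

lemma exp_abs_logRatio_le (hr : r ∈ Ioo (0 : ℝ) 2) :
    Real.exp |logRatio r| ≤ 4 / (r * (2 - r)) := by
  have h0 := hr.1
  have h2 : 0 < 2 - r := sub_pos.2 hr.2
  rcases abs_cases (logRatio r) with ⟨h, -⟩ | ⟨h, -⟩
  · rw [h, logRatio, Real.exp_sub, Real.exp_log h0, Real.exp_log h2,
      div_le_div_iff₀ h2 (by positivity)]
    nlinarith [mul_pos h0 h2]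
  · rw [h, logRatio, neg_sub, Real.exp_sub, Real.exp_log h0, Real.exp_log h2,
      div_le_div_iff₀ h0 (by positivity)]
    nlinarith [mul_pos h0 h2]

end LogRatio

lemma le_sqrt_of_forall_le_add_div {d q : ℝ} (hq : 0 ≤ q) (h : ∀ t > 0, d ≤ t + q / (4 * t)) :
    d ≤ √q := by
  rcases hq.eq_or_lt with rfl | hq
  · simpa using le_of_forall_pos_le_add fun t ht => by simpa using h t ht
  · have := Real.sqrt_pos.2 hq
    refine (h (√q / 2) (by positivity)).trans_eq ?_
    nth_rw 2 [← Real.sq_sqrt hq.le]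
    field_simp
    norm_num

lemma sqrt_div_le {κ η x : ℝ} (hκ : 0 < κ) (hη : 0 < η) (hx : 0 ≤ x) :
    √(x / κ) ≤ 1 / (4 * η * κ) + η * x := by
  have h : (1 / (4 * η * κ) + η * x) ^ 2 - x / κ = (1 / (4 * η * κ) - η * x) ^ 2 := by
    field_simp
    ring
  exact (Real.sqrt_le_left (by positivity)).2 (by nlinarith [sq_nonneg (1 / (4 * η * κ) - η * x)])

/-- The pairs `(u, φ)` of a metric with nonnegative scalar curvature whose profile `u` is bounded
below by `κ r (2 - r)`; this lower bound is what `MinA` is used for. -/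
structure NoncollapsedPair (κ : ℝ) (u : ℝ → ℝ) (φ : S2 → ℝ) : Prop extends IsWarpingPair u φ where
  gradientBound : GradientBound u φ
  mul_le_u : ∀ r ∈ Icc (0 : ℝ) 2, κ * (r * (2 - r)) ≤ u r

section Oscillation

variable {κ : ℝ} {u : ℝ → ℝ} {φ : S2 → ℝ} {r s : ℝ}

lemma NoncollapsedPair.abs_deriv_logPolar_le (h : NoncollapsedPair κ u φ) (hκ : 0 < κ)
    (hr : r ∈ Ioo (0 : ℝ) 2) (θ : ℝ) {t : ℝ} (ht : 0 < t) :
    |deriv (fun s => logPolar φ s θ) r|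
      ≤ t / 2 * -deriv (deriv u) r + 2 / (r * (2 - r)) / (4 * t * κ) := by
  have hu := h.u_pos r hr
  have hb := h.gradientBound r hr θ
  have hr2 : 0 < 2 - r := sub_pos.2 hr.2
  have hr0 : 0 < r := hr.1
  set D := deriv (fun s => logPolar φ s θ) r
  have hang : 0 ≤ deriv (fun t => logPolar φ r t) θ ^ 2 / u r := by positivity
  have hAMGM : |D| ≤ t / 2 * (u r * D ^ 2) + 1 / (2 * t * u r) := by
    have hsq : t / 2 * (u r * D ^ 2) + 1 / (2 * t * u r) - |D|
        = (t * u r * |D| - 1) ^ 2 / (2 * t * u r) := by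
      rw [← sq_abs D]
      field_simp
      ring
    have : 0 ≤ (t * u r * |D| - 1) ^ 2 / (2 * t * u r) := by positivity
    linarith
  refine hAMGM.trans (add_le_add (mul_le_mul_of_nonneg_left (by linarith) (by positivity)) ?_)
  calc 1 / (2 * t * u r) ≤ 1 / (2 * t * (κ * (r * (2 - r)))) := by
        gcongr
        exact h.mul_le_u r (Ioo_subset_Icc_self hr)
    _ = 2 / (r * (2 - r)) / (4 * t * κ) := by
        generalize 2 - r = y at *
        field_simp
        norm_num

lemma NoncollapsedPair.abs_sub_le_add_div (h : NoncollapsedPair κ u φ) (hκ : 0 < κ)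
    (hs : s ∈ Ioo (0 : ℝ) 2) (hr : r ∈ Ioo (0 : ℝ) 2) (hsr : s ≤ r) (θ : ℝ) {t : ℝ} (ht : 0 < t) :
    |logPolar φ r θ - logPolar φ s θ| ≤ t + (logRatio r - logRatio s) / (4 * t * κ) := by
  have hsub : Icc s r ⊆ Ioo 0 2 := Icc_subset_Ioo hs.1 hr.2
  have hf : Differentiable ℝ fun x => logPolar φ x θ :=
    (h.contDiff_logPolar contDiff_id contDiff_const).differentiable (by simp)
  have hB (x) (hx : x ∈ Icc s r) : HasDerivAt
      (fun x => t / 2 * (deriv u s - deriv u x) + (logRatio x - logRatio s) / (4 * t * κ))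
      (t / 2 * -deriv (deriv u) x + 2 / (x * (2 - x)) / (4 * t * κ)) x :=
    (((h.differentiableAt_deriv (hsub hx)).hasDerivAt.const_sub _).const_mul _).add
      (((hasDerivAt_logRatio (hsub hx)).sub_const _).div_const _)
  have hle := image_norm_le_of_norm_deriv_right_le_deriv_boundary'
    (f := fun x => logPolar φ x θ - logPolar φ s θ)
    (hf.continuous.sub continuous_const).continuousOn
    (fun x _ => ((hf x).hasDerivAt.sub_const _).hasDerivWithinAt)
    (by simp) (fun x hx => (hB x hx).continuousAt.continuousWithinAt)
    (fun x hx => (hB x (Ico_subset_Icc_self hx)).hasDerivWithinAt)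
    (fun x hx => h.abs_deriv_logPolar_le hκ (hsub (Ico_subset_Icc_self hx)) θ ht)
    (right_mem_Icc.2 hsr)
  refine hle.trans (add_le_add_left ?_ _)
  nlinarith [(abs_le.1 (h.abs_deriv_le h.gradientBound hr)).1,
    (abs_le.1 (h.abs_deriv_le h.gradientBound hs)).2]

theorem NoncollapsedPair.abs_sub_radial_le (h : NoncollapsedPair κ u φ) (hκ : 0 < κ)
    (hr : r ∈ Ioo (0 : ℝ) 2) (hs : s ∈ Ioo (0 : ℝ) 2) (θ : ℝ) :
    |logPolar φ r θ - logPolar φ s θ| ≤ √(|logRatio r - logRatio s| / κ) := by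
  wlog hsr : s ≤ r generalizing r s
  · rw [abs_sub_comm, abs_sub_comm (logRatio r)]
    exact this hs hr (le_of_not_ge hsr)
  refine le_sqrt_of_forall_le_add_div (by positivity) fun t ht => ?_
  rw [abs_of_nonneg (sub_nonneg.2 (monotoneOn_logRatio hs hr hsr)), div_div, mul_comm κ]
  exact h.abs_sub_le_add_div hκ hs hr hsr θ ht

lemma IsWarpingPair.exists_neg_deriv_deriv_le (hw : IsWarpingPair u φ) (hg : GradientBound u φ)
    (hr : r ∈ Ioo (0 : ℝ) 2) {δ : ℝ} (hδ : 0 < δ) (hrδ : r + δ ∈ Ioo (0 : ℝ) 2) :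
    ∃ s ∈ Ioo r (r + δ), -deriv (deriv u) s ≤ 2 / δ := by
  have hsub : Icc r (r + δ) ⊆ Ioo (0 : ℝ) 2 := Icc_subset_Ioo hr.1 hrδ.2
  obtain ⟨s, hs, hds⟩ := exists_deriv_eq_slope (deriv u) (lt_add_of_pos_right r hδ)
    (fun x hx => (hw.differentiableAt_deriv (hsub hx)).continuousAt.continuousWithinAt)
    (fun x hx => (hw.differentiableAt_deriv
      (hsub (Ioo_subset_Icc_self hx))).differentiableWithinAt)
  refine ⟨s, hs, ?_⟩
  rw [hds, add_sub_cancel_left, ← neg_div]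
  gcongr
  linarith [(abs_le.1 (hw.abs_deriv_le hg hr)).2, (abs_le.1 (hw.abs_deriv_le hg hrδ)).1]

lemma IsWarpingPair.abs_sub_circle_le (hw : IsWarpingPair u φ) (hg : GradientBound u φ)
    (hr : r ∈ Ioo (0 : ℝ) 2) {K : ℝ} (hK : -deriv (deriv u) r ≤ K) (θ θ' : ℝ) :
    |logPolar φ r θ - logPolar φ r θ'| ≤ (1 + K) * |θ - θ'| := by
  have hf : Differentiable ℝ fun t => logPolar φ r t :=
    (hw.contDiff_logPolar contDiff_const contDiff_id).differentiable (by simp)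
  refine (convex_univ (𝕜 := ℝ)).norm_image_sub_le_of_norm_deriv_le (fun t _ => hf t)
    (fun t _ => ?_) (mem_univ θ') (mem_univ θ)
  have hu := hw.u_pos r hr
  have hu1 : u r ≤ 1 := by
    rcases le_min_iff.1 (hw.u_le_min hg (Ioo_subset_Icc_self hr)) with ⟨h0, h2⟩
    linarith
  rw [Real.norm_eq_abs]
  set D := deriv (fun t => logPolar φ r t) t
  have hrad : 0 ≤ u r * deriv (fun s => logPolar φ s t) r ^ 2 := by positivity
  have hD : D ^ 2 ≤ K := calc
    D ^ 2 ≤ D ^ 2 / u r := le_div_self (sq_nonneg D) hu hu1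
    _ ≤ K := by linarith [hg r hr t]
  nlinarith [sq_abs D, sq_nonneg (|D| - 1)]

-- The bound on `-u''` is available only on some circle near `r`; the two radial segments from
-- the circle `r` to that one account for the first term.
theorem NoncollapsedPair.abs_sub_angular_le (h : NoncollapsedPair κ u φ) (hκ : 0 < κ)
    (hr : r ∈ Ioo (0 : ℝ) 2) {δ : ℝ} (hδ : 0 < δ) (hrδ : r + δ ∈ Ioo (0 : ℝ) 2) (θ θ' : ℝ) :
    |logPolar φ r θ - logPolar φ r θ'|
      ≤ 2 * √(|logRatio (r + δ) - logRatio r| / κ) + (1 + 2 / δ) * |θ - θ'| := by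
  obtain ⟨s, hs, hds⟩ := h.exists_neg_deriv_deriv_le h.gradientBound hr hδ hrδ
  have hs2 : s ∈ Ioo (0 : ℝ) 2 := ⟨hr.1.trans hs.1, hs.2.trans hrδ.2⟩
  have hmono : √(|logRatio s - logRatio r| / κ) ≤ √(|logRatio (r + δ) - logRatio r| / κ) := by
    have hrs := monotoneOn_logRatio hr hs2 hs.1.le
    have hsδ := monotoneOn_logRatio hs2 hrδ hs.2.le
    rw [abs_of_nonneg (by linarith), abs_of_nonneg (by linarith)]
    gcongr
  have hθ := (h.abs_sub_radial_le hκ hs2 hr θ).trans hmono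
  have hθ' := (h.abs_sub_radial_le hκ hs2 hr θ').trans hmono
  have hang := h.abs_sub_circle_le h.gradientBound hs2 hds θ θ'
  rw [abs_le] at hθ hθ' hang ⊢
  constructor <;> linarith [hθ.1, hθ.2, hθ'.1, hθ'.2, hang.1, hang.2]

theorem exists_abs_logPolar_sub_le (hκ : 0 < κ) {η : ℝ} (hη : 0 < η) :
    ∃ K : ℝ, ∀ u φ, NoncollapsedPair κ u φ → ∀ r ∈ Ioo (0 : ℝ) 2, ∀ θ,
      |logPolar φ r θ - logPolar φ 1 0| ≤ K + η * |logRatio r| := by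
  refine ⟨1 / (4 * η * κ) + (2 * √(|logRatio (1 + 1 / 2) - logRatio 1| / κ)
    + (1 + 2 / (1 / 2)) * (2 * π)), fun u φ h r hr θ => ?_⟩
  obtain ⟨n, hn⟩ := exists_add_int_mul_two_pi_mem_Icc θ
  rw [← logPolar_add_int_mul_two_pi r θ n]
  set θ' := θ + n * (2 * π)
  have hrad : |logPolar φ r θ' - logPolar φ 1 θ'| ≤ 1 / (4 * η * κ) + η * |logRatio r| := by
    have := h.abs_sub_radial_le hκ hr (s := 1) (by norm_num) θ'
    rw [logRatio_one, sub_zero] at this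
    exact this.trans (sqrt_div_le hκ hη (abs_nonneg _))
  have hang := h.abs_sub_angular_le hκ (r := 1) (by norm_num) one_half_pos (by norm_num) θ' 0
  have hθ' : |θ' - 0| ≤ 2 * π := by
    rw [sub_zero, abs_of_nonneg hn.1]
    exact hn.2
  rw [abs_le] at hrad hang ⊢
  constructor <;> linarith [hrad.1, hrad.2, hang.1, hang.2]

end Oscillation

section Normalization

variable {κ K V₀ A₀ : ℝ} {u : ℝ → ℝ} {φ : S2 → ℝ}

lemma NoncollapsedPair.le_vol (h : NoncollapsedPair κ u φ) (hκ : 0 < κ)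
    (hK : ∀ r ∈ Ioo (0 : ℝ) 2, ∀ θ, logPolar φ r θ ≤ logPolar φ 1 0 + K + |logRatio r|) :
    ENNReal.ofReal (4 * π ^ 2 * (9 / 64 * κ * Real.exp (-(logPolar φ 1 0 + K))))
      ≤ vol (warpedMetric u φ) := by
  refine le_vol_warpedMetric h.toIsWarpingPair (by positivity) fun r hr θ => ?_
  have hr2 : r ∈ Ioo (0 : ℝ) 2 := ⟨by linarith [hr.1], by linarith [hr.2]⟩
  have hrr : 3 / 4 ≤ r * (2 - r) := by nlinarith [hr.1, hr.2]
  set b := logPolar φ 1 0 + K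
  have hφ : φ (polarPt r θ) ≤ Real.exp b * (16 / 3) := calc
    φ (polarPt r θ) = Real.exp (logPolar φ r θ) := (exp_logPolar h.φ_pos r θ).symm
    _ ≤ Real.exp (b + |logRatio r|) := Real.exp_le_exp.2 (hK r hr2 θ)
    _ = Real.exp b * Real.exp |logRatio r| := Real.exp_add _ _
    _ ≤ Real.exp b * (4 / (3 / 4)) := by
      gcongr
      exact (exp_abs_logRatio_le hr2).trans (by gcongr)
    _ = Real.exp b * (16 / 3) := by norm_num
  rw [le_div_iff₀ (h.φ_pos _)]
  calc 9 / 64 * κ * Real.exp (-b) * φ (polarPt r θ)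
      ≤ 9 / 64 * κ * Real.exp (-b) * (Real.exp b * (16 / 3)) := by gcongr
    _ = κ * (3 / 4) := by
      rw [Real.exp_neg]
      field_simp
      norm_num
    _ ≤ κ * (r * (2 - r)) := by gcongr
    _ ≤ u r := h.mul_le_u r (Ioo_subset_Icc_self hr2)

lemma NoncollapsedPair.minA_le (h : NoncollapsedPair κ u φ)
    (hK : ∀ r ∈ Ioo (0 : ℝ) 2, ∀ θ, logPolar φ 1 0 ≤ logPolar φ r θ + K + |logRatio r| / 2) :
    minA (warpedMetric u φ)
      ≤ ENNReal.ofReal (4 * π * (4 * Real.exp (2 * (K - logPolar φ 1 0)))) := by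
  refine (iInf₂_le _ (isClosedMinimalSurface_zeroSphere h.toIsWarpingPair)).trans
    (area_zeroSphere_le h.toIsWarpingPair (by positivity) fun r hr θ => ?_)
  have hr2 : 0 < 2 - r := sub_pos.2 hr.2
  have hr0 : 0 < r := hr.1
  set b := K - logPolar φ 1 0
  have hu : u r ≤ r * (2 - r) := by
    have hmin := h.u_le_min h.gradientBound (Ioo_subset_Icc_self hr)
    rcases le_total r 1 with hr1 | hr1
    · nlinarith [hmin.trans (min_le_left _ _)]
    · nlinarith [hmin.trans (min_le_right _ _)]
  have hφ : (φ (polarPt r θ) ^ 2)⁻¹ ≤ Real.exp (2 * b) * (4 / (r * (2 - r))) := calc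
    (φ (polarPt r θ) ^ 2)⁻¹ = Real.exp (-(2 * logPolar φ r θ)) := by
      rw [← exp_logPolar h.φ_pos, ← Real.exp_nat_mul, ← Real.exp_neg, Nat.cast_two]
    _ ≤ Real.exp (2 * b + |logRatio r|) := Real.exp_le_exp.2 (by linarith [hK r hr θ])
    _ = Real.exp (2 * b) * Real.exp |logRatio r| := Real.exp_add _ _
    _ ≤ Real.exp (2 * b) * (4 / (r * (2 - r))) := by
      gcongr
      exact exp_abs_logRatio_le hr
  calc u r / φ (polarPt r θ) ^ 2
      ≤ r * (2 - r) * (Real.exp (2 * b) * (4 / (r * (2 - r)))) :=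
        mul_le_mul hu hφ (by positivity) (by positivity)
    _ = 4 * Real.exp (2 * b) := by
      generalize 2 - r = y at *
      field_simp

/-- The pairs `(u, φ)` to which the theorem applies: `warpedMetric u φ` has nonnegative scalar
curvature, volume at most `V₀`, and no closed minimal surface of area less than `A₀`. -/
structure AdmissiblePair (V₀ A₀ : ℝ) (u : ℝ → ℝ) (φ : S2 → ℝ) : Prop
    extends IsWarpingPair u φ where
  scalarCurvature_nonneg : ∀ x ∈ strip, 0 ≤ scalarCurvature (warpedMetric u φ) x
  vol_le : vol (warpedMetric u φ) ≤ ENNReal.ofReal V₀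
  le_minA : ENNReal.ofReal A₀ ≤ minA (warpedMetric u φ)

lemma AdmissiblePair.gradientBound (h : AdmissiblePair V₀ A₀ u φ) : GradientBound u φ :=
  h.toIsWarpingPair.gradientBound h.scalarCurvature_nonneg

lemma AdmissiblePair.noncollapsedPair (h : AdmissiblePair V₀ A₀ u φ) :
    NoncollapsedPair (A₀ / (16 * π ^ 2)) u φ where
  toIsWarpingPair := h.toIsWarpingPair
  gradientBound := h.gradientBound
  mul_le_u _ hr := h.mul_le_of_le_minA h.gradientBound h.le_minA hr

theorem exists_abs_logPolar_one_le (hA₀ : 0 < A₀) (V₀ : ℝ) :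
    ∃ C : ℝ, ∀ u φ, AdmissiblePair V₀ A₀ u φ → |logPolar φ 1 0| ≤ C := by
  have hκ : 0 < A₀ / (16 * π ^ 2) := by positivity
  obtain ⟨K, hK⟩ := exists_abs_logPolar_sub_le hκ one_pos
  obtain ⟨K', hK'⟩ := exists_abs_logPolar_sub_le hκ one_half_pos
  set D : ℝ := 4 * π ^ 2 * (9 / 64 * (A₀ / (16 * π ^ 2)))
  have hD : 0 < D := by positivity
  refine ⟨max (Real.log (V₀ / D) + K) (K' - Real.log (A₀ / (16 * π)) / 2), fun u φ h => ?_⟩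
  have hn := h.noncollapsedPair
  set a := logPolar φ 1 0
  have hlower : D * Real.exp (-(a + K)) ≤ V₀ := by
    have hvol := (hn.le_vol (K := K) hκ fun r hr θ => by
      linarith [(abs_le.1 (hK u φ hn r hr θ)).2]).trans h.vol_le
    rw [← mul_assoc (4 * π ^ 2), ENNReal.ofReal_le_ofReal_iff'] at hvol
    exact hvol.resolve_right (not_le.2 (by positivity))
  have hupper : A₀ ≤ 4 * π * (4 * Real.exp (2 * (K' - a))) :=
    (ENNReal.ofReal_le_ofReal_iff (by positivity)).1 <|
      h.le_minA.trans (hn.minA_le (K := K') fun r hr θ => by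
        linarith [(abs_le.1 (hK' u φ hn r hr θ)).1])
  refine abs_le'.2 ⟨le_max_of_le_right ?_, le_max_of_le_left ?_⟩
  · have := (Real.log_le_iff_le_exp (y := 2 * (K' - a)) (x := A₀ / (16 * π)) (by positivity)).2
      ((div_le_iff₀ (by positivity)).2 (by linarith))
    linarith
  · have hV₀ : 0 < V₀ := (by positivity : 0 < D * Real.exp (-(a + K))).trans_le hlower
    have := (Real.le_log_iff_exp_le (x := -(a + K)) (y := V₀ / D) (by positivity)).2
      ((le_div_iff₀' hD).2 hlower)
    linarith

theorem exists_abs_logPolar_le (hA₀ : 0 < A₀) (V₀ : ℝ) {η : ℝ} (hη : 0 < η) :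
    ∃ C : ℝ, ∀ u φ, AdmissiblePair V₀ A₀ u φ → ∀ r ∈ Ioo (0 : ℝ) 2, ∀ θ,
      |logPolar φ r θ| ≤ C + η * |logRatio r| := by
  obtain ⟨C, hC⟩ := exists_abs_logPolar_one_le hA₀ V₀
  obtain ⟨K, hK⟩ := exists_abs_logPolar_sub_le (κ := A₀ / (16 * π ^ 2)) (by positivity) hη
  refine ⟨C + K, fun u φ h r hr θ => ?_⟩
  linarith [hC u φ h, hK u φ h.noncollapsedPair r hr θ,
    abs_sub_abs_le_abs_sub (logPolar φ r θ) (logPolar φ 1 0)]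

end Normalization

/-! ### Sequential compactness -/

section LocallyUniformConvergence

variable {ι X E : Type*} [TopologicalSpace X]

theorem exists_subseq_tendstoLocallyUniformly [WeaklyLocallyCompactSpace X] [SigmaCompactSpace X]
    [MetricSpace E] [ProperSpace E] {F : ℕ → X → E} (hF : Equicontinuous F)
    (hb : ∀ x, Bornology.IsBounded (range fun i => F i x)) :
    ∃ (σ : ℕ → ℕ) (f : X → E), StrictMono σ ∧
      TendstoLocallyUniformly (fun i => F (σ i)) f atTop := by
  let G : ℕ → C(X, E) := fun i => ⟨F i, hF.continuous i⟩
  have hemb : IsClosedEmbedding (UniformOnFun.ofFun {K : Set X | IsCompact K} ∘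
      (DFunLike.coe : C(X, E) → X → E)) :=
    have : T2Space (UniformOnFun X E {K | IsCompact K}) :=
      UniformOnFun.t2Space_of_covering sUnion_isCompact_eq_univ
    ContinuousMap.isUniformEmbedding_toUniformOnFunIsCompact.isClosedEmbedding
  have heq : Equicontinuous ((DFunLike.coe : C(X, E) → X → E) ∘ ((↑) : range G → C(X, E))) := by
    intro x V hV
    filter_upwards [hF x V hV] with y hy
    rintro ⟨_, i, rfl⟩
    exact hy i
  have hcpt : IsCompact (closure (range G)) :=
    ArzelaAscoli.isCompact_closure_of_isClosedEmbedding (fun _ hK => hK) hemb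
      (fun K _ => heq.equicontinuousOn K) fun _ _ x _ => ⟨_, (hb x).isCompact_closure, by
        rintro _ ⟨i, rfl⟩
        exact subset_closure (mem_range_self i)⟩
  obtain ⟨f, -, σ, hσ, hf⟩ := hcpt.tendsto_subseq fun i => subset_closure (mem_range_self i)
  exact ⟨σ, f, hσ, ContinuousMap.tendsto_iff_tendstoLocallyUniformly.1 hf⟩

theorem exists_subseq_tendstoLocallyUniformlyOn [MetricSpace E] [ProperSpace E] {S : Set X}
    [WeaklyLocallyCompactSpace S] [SigmaCompactSpace S] {F : ℕ → X → E}
    (hF : EquicontinuousOn F S) (hb : ∀ x ∈ S, Bornology.IsBounded (range fun i => F i x)) :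
    ∃ (σ : ℕ → ℕ) (f : X → E), StrictMono σ ∧
      TendstoLocallyUniformlyOn (fun i => F (σ i)) f atTop S := by
  obtain ⟨σ, f, hσ, hf⟩ := exists_subseq_tendstoLocallyUniformly
    ((equicontinuous_restrict_iff F).2 hF) fun x => hb x x.2
  refine ⟨σ, Function.extend (↑) f (F 0), hσ, ?_⟩
  rw [tendstoLocallyUniformlyOn_iff_tendstoLocallyUniformly_comp_coe,
    Function.extend_comp Subtype.val_injective]
  exact hf

lemma tendstoLocallyUniformlyOn_continuous_comp {E' : Type*} [UniformSpace E] [UniformSpace E']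
    {g : E → E'} (hg : Continuous g) {S : Set X} {p : Filter ι} {F : ι → X → E} {f : X → E}
    (hF : TendstoLocallyUniformlyOn F f p S) (hf : ContinuousOn f S) :
    TendstoLocallyUniformlyOn (fun i x => g (F i x)) (fun x => g (f x)) p S := by
  rw [tendstoLocallyUniformlyOn_iff_forall_tendsto] at hF ⊢
  intro x hx
  have hfx : Tendsto (fun q : ι × X => f q.2) (p ×ˢ 𝓝[S] x) (𝓝 (f x)) :=
    (hf x hx).tendsto.comp tendsto_snd
  have hFx : Tendsto (fun q : ι × X => F q.1 q.2) (p ×ˢ 𝓝[S] x) (𝓝 (f x)) :=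
    hfx.congr_uniformity (hF x hx)
  exact (((hg.tendsto _).comp hfx).prodMk_nhds ((hg.tendsto _).comp hFx)).mono_right
    (nhds_le_uniformity _)

end LocallyUniformConvergence

section PolarConvergence

variable {ι E : Type*} {p : Filter ι}

lemma tendstoUniformlyOn_MEps [UniformSpace E] {T : ι → Coord → E} {T' : Coord → E}
    (h : TendstoLocallyUniformlyOn T T' p strip)
    (hT : ∀ i x (n : ℤ), T i ![x 0, x 1 + n * (2 * π), 0] = T i x)
    (hT' : ∀ x (n : ℤ), T' ![x 0, x 1 + n * (2 * π), 0] = T' x) {ε : ℝ} (hε : 0 < ε) :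
    TendstoUniformlyOn T T' p (MEps ε) := by
  have hK : Icc (![ε, 0, 0] : Coord) ![2 - ε, 2 * π, 0] ⊆ strip := fun x hx =>
    ⟨hε.trans_le (hx.1 0), (hx.2 0).trans_lt (sub_lt_self 2 hε)⟩
  intro V hV
  filter_upwards [(tendstoLocallyUniformlyOn_iff_tendstoUniformlyOn_of_compact isCompact_Icc).1
    (h.mono hK) V hV] with i hi x hx
  obtain ⟨n, hn⟩ := exists_add_int_mul_two_pi_mem_Icc (x 1)
  rw [← hT' x n, ← hT i x n]
  refine hi _ ⟨?_, ?_⟩ <;> intro a <;> fin_cases a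
  exacts [hx.1, hn.1, le_rfl, hx.2, hn.2, le_rfl]

lemma tendstoUniformlyOn_OmegaEps {φ : ι → S2 → ℝ} {ψ : S2 → ℝ}
    (h : TendstoLocallyUniformlyOn (fun i x => φ i (polarPt (x 0) (x 1)))
      (fun x => ψ (polarPt (x 0) (x 1))) p strip) {ε : ℝ} (hε : 0 < ε) :
    TendstoUniformlyOn φ ψ p (OmegaEps ε) := by
  intro V hV
  filter_upwards [tendstoUniformlyOn_MEps h (by simp [polarPt_add_int_mul_two_pi])
    (by simp [polarPt_add_int_mul_two_pi]) hε V hV] with i hi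
  rintro _ ⟨r, hr, θ, rfl⟩
  exact hi ![r, θ, 0] hr

lemma continuous_diagonal_exp : Continuous fun q : ℝ × ℝ =>
    (Matrix.diagonal ![Real.exp (-2 * q.1), Real.exp (-2 * q.1) * q.2 ^ 2, Real.exp (2 * q.1)] :
      Matrix (Fin 3) (Fin 3) ℝ) := by
  refine Continuous.matrix_diagonal (continuous_pi fun a => ?_)
  fin_cases a <;> dsimp <;> fun_prop

variable {S : Set Coord} {F V : ι → Coord → ℝ} {f v : Coord → ℝ}

lemma continuousOn_expMetric (hf : ContinuousOn f S) (hv : ContinuousOn v S) :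
    ContinuousOn (expMetric f v) S :=
  continuous_diagonal_exp.comp_continuousOn (hf.prodMk hv)

lemma tendstoLocallyUniformlyOn_expMetric (hF : TendstoLocallyUniformlyOn F f p S)
    (hV : TendstoLocallyUniformlyOn V v p S) (hf : ContinuousOn f S) (hv : ContinuousOn v S) :
    TendstoLocallyUniformlyOn (fun i => expMetric (F i) (V i)) (expMetric f v) p S :=
  tendstoLocallyUniformlyOn_continuous_comp continuous_diagonal_exp (hF.prodMk hV) (hf.prodMk hv)

end PolarConvergence

section Compactness

variable {κ : ℝ} {u : ℕ → ℝ → ℝ} {φ : ℕ → S2 → ℝ}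

theorem equicontinuousOn_logPolar (hκ : 0 < κ) (h : ∀ i, NoncollapsedPair κ (u i) (φ i)) :
    EquicontinuousOn (fun i (x : Coord) => logPolar (φ i) (x 0) (x 1)) strip := by
  intro x hx
  refine EquicontinuousAt.equicontinuousWithinAt (Metric.equicontinuousAt_iff_right.2 ?_) strip
  intro ε hε
  have hL : ContinuousAt logRatio (x 0) := (hasDerivAt_logRatio hx).continuousAt
  obtain ⟨δ, ⟨hδε, hδ2⟩, hδ⟩ : ∃ δ : ℝ,
      (2 * √(|logRatio (x 0 + δ) - logRatio (x 0)| / κ) < ε ∧ x 0 + δ < 2) ∧ 0 < δ := by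
    have hadd : ContinuousAt (fun δ => x 0 + δ) 0 := by fun_prop
    have hosc : ContinuousAt
        (fun δ => 2 * √(|logRatio (x 0 + δ) - logRatio (x 0)| / κ)) 0 := by
      have := ContinuousAt.comp_of_eq hL hadd (add_zero _)
      fun_prop
    exact ((((hosc.eventually_lt_const (by simpa using hε)).and
      (hadd.eventually_lt_const (by simpa using hx.2))).filter_mono nhdsWithin_le_nhds).and
      (self_mem_nhdsWithin (s := Ioi 0))).exists
  have hmod : ContinuousAt (fun y : Coord => √(|logRatio (y 0) - logRatio (x 0)| / κ) +
      (2 * √(|logRatio (x 0 + δ) - logRatio (x 0)| / κ) + (1 + 2 / δ) * |y 1 - x 1|)) x := by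
    have : ContinuousAt (fun y : Coord => logRatio (y 0)) x :=
      hL.comp_of_eq (continuous_apply 0).continuousAt rfl
    have hθ : Continuous fun y : Coord => |y 1 - x 1| :=
      ((continuous_apply 1).sub continuous_const).abs
    exact ((this.sub continuousAt_const).abs.div_const κ).sqrt.add
      (continuous_const.add (continuous_const.mul hθ)).continuousAt
  filter_upwards [hmod.eventually_lt_const (by simpa using hδε), isOpen_strip.mem_nhds hx]
    with y hyε hy i
  rw [dist_comm]
  refine lt_of_le_of_lt ?_ hyε
  calc |logPolar (φ i) (y 0) (y 1) - logPolar (φ i) (x 0) (x 1)|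
      ≤ |logPolar (φ i) (y 0) (y 1) - logPolar (φ i) (x 0) (y 1)|
        + |logPolar (φ i) (x 0) (y 1) - logPolar (φ i) (x 0) (x 1)| := abs_sub_le _ _ _
    _ ≤ _ := add_le_add ((h i).abs_sub_radial_le hκ hy hx _)
      ((h i).abs_sub_angular_le hκ hx hδ ⟨by linarith [hx.1], hδ2⟩ _ _)

theorem exists_subseq_tendstoUniformlyOn (hw : ∀ i, IsWarpingPair (u i) (φ i))
    (hg : ∀ i, GradientBound (u i) (φ i)) : ∃ (σ : ℕ → ℕ) (uInf : ℝ → ℝ), StrictMono σ ∧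
      TendstoUniformlyOn (fun i => u (σ i)) uInf atTop (Icc 0 2) := by
  have hlip (i) : LipschitzOnWith 1 (u i) (Icc 0 2) := LipschitzOnWith.of_dist_le_mul
    fun r hr s hs => by simpa [Real.dist_eq] using (hw i).abs_sub_le (hg i) hr hs
  obtain ⟨σ, uInf, hσ, hu⟩ := exists_subseq_tendstoLocallyUniformlyOn (F := u)
    (LipschitzOnWith.uniformEquicontinuousOn u 1 hlip).equicontinuousOn
    fun r hr => (Metric.isBounded_Icc 0 r).subset <| range_subset_iff.2 fun i =>
      ⟨(hw i).u_nonneg hr, ((hw i).u_le_min (hg i) hr).trans (min_le_left _ _)⟩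
  exact ⟨σ, uInf, hσ,
    (tendstoLocallyUniformlyOn_iff_tendstoUniformlyOn_of_compact isCompact_Icc).1 hu⟩

/-- Convergence of `u i` on `[0, 2]` and of `log (φ i)` away from the poles. -/
structure WarpingTendsto (u : ℕ → ℝ → ℝ) (φ : ℕ → S2 → ℝ) (uInf : ℝ → ℝ) (φInf : S2 → ℝ) :
    Prop where
  u_tendsto : TendstoUniformlyOn u uInf atTop (Icc 0 2)
  φ_pos : ∀ q, 0 < φInf q
  log_tendsto : TendstoLocallyUniformlyOn (fun i (x : Coord) => logPolar (φ i) (x 0) (x 1))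
    (fun x => logPolar φInf (x 0) (x 1)) atTop strip

theorem exists_subseq_warpingTendsto {V₀ A₀ : ℝ} (hA₀ : 0 < A₀)
    (h : ∀ i, AdmissiblePair V₀ A₀ (u i) (φ i)) :
    ∃ (σ : ℕ → ℕ) (uInf : ℝ → ℝ) (φInf : S2 → ℝ), StrictMono σ ∧
      WarpingTendsto (fun i => u (σ i)) (fun i => φ (σ i)) uInf φInf := by
  obtain ⟨σ, uInf, hσ, hu⟩ :=
    exists_subseq_tendstoUniformlyOn (fun i => (h i).toIsWarpingPair) fun i => (h i).gradientBound
  obtain ⟨C, hC⟩ := exists_abs_logPolar_le hA₀ V₀ one_pos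
  have : LocallyCompactSpace strip := isOpen_strip.locallyCompactSpace
  obtain ⟨τ, f, hτ, hf⟩ := exists_subseq_tendstoLocallyUniformlyOn
    (equicontinuousOn_logPolar (by positivity) fun i => (h (σ i)).noncollapsedPair)
    fun x hx => Metric.isBounded_closedBall.subset <| range_subset_iff.2 fun i =>
      mem_closedBall_zero_iff.2 (hC _ _ (h (σ i)) (x 0) hx (x 1))
  refine ⟨σ ∘ τ, uInf, fun q => Real.exp (limUnder atTop fun i => Real.log (φ (σ (τ i)) q)),
    hσ.comp hτ, fun V hV => hτ.tendsto_atTop.eventually (hu V hV), fun _ => Real.exp_pos _,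
    hf.congr_right fun x hx => ?_⟩
  rw [logPolar, Real.log_exp]
  exact (hf.tendsto_at hx).limUnder_eq.symm

end Compactness

/-! ### Convergence of the metrics -/

section Limits

variable {κ : ℝ} {u : ℕ → ℝ → ℝ} {φ : ℕ → S2 → ℝ} {uInf : ℝ → ℝ} {φInf : S2 → ℝ}

lemma WarpingTendsto.le_u (h : WarpingTendsto u φ uInf φInf)
    (hκ : ∀ i, NoncollapsedPair κ (u i) (φ i)) {r : ℝ} (hr : r ∈ Icc (0 : ℝ) 2) :
    κ * (r * (2 - r)) ≤ uInf r :=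
  ge_of_tendsto' (h.u_tendsto.tendsto_at hr) fun i => (hκ i).mul_le_u r hr

lemma WarpingTendsto.u_le_min (h : WarpingTendsto u φ uInf φInf)
    (hκ : ∀ i, NoncollapsedPair κ (u i) (φ i)) {r : ℝ} (hr : r ∈ Icc (0 : ℝ) 2) :
    uInf r ≤ min r (2 - r) :=
  le_of_tendsto' (h.u_tendsto.tendsto_at hr) fun i =>
    (hκ i).toIsWarpingPair.u_le_min (hκ i).gradientBound hr

lemma WarpingTendsto.abs_logPolar_le (h : WarpingTendsto u φ uInf φInf) {B r θ : ℝ}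
    (hr : r ∈ Ioo (0 : ℝ) 2) (hB : ∀ i, |logPolar (φ i) r θ| ≤ B) : |logPolar φInf r θ| ≤ B :=
  le_of_tendsto' (h.log_tendsto.tendsto_at (a := ![r, θ, 0]) hr).abs hB

lemma IsWarpingPair.continuousOn_warpedMetric {v : ℝ → ℝ} {ψ : S2 → ℝ}
    (hw : IsWarpingPair v ψ) : ContinuousOn (warpedMetric v ψ) strip := by
  rw [warpedMetric_eq_expMetric hw.φ_pos]
  exact continuousOn_expMetric
    (hw.contDiff_logPolar (by fun_prop) (by fun_prop)).continuous.continuousOn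
    (hw.u_smooth.continuousOn.comp (continuous_apply 0).continuousOn fun _ hx =>
      Ioo_subset_Icc_self hx)

lemma WarpingTendsto.continuousOn_logPolar (h : WarpingTendsto u φ uInf φInf)
    (hw : ∀ i, IsWarpingPair (u i) (φ i)) :
    ContinuousOn (fun x : Coord => logPolar φInf (x 0) (x 1)) strip :=
  h.log_tendsto.continuousOn <| .of_forall fun i =>
    ((hw i).contDiff_logPolar (by fun_prop) (by fun_prop)).continuous.continuousOn

lemma WarpingTendsto.continuousOn_u (h : WarpingTendsto u φ uInf φInf)
    (hw : ∀ i, IsWarpingPair (u i) (φ i)) : ContinuousOn (fun x : Coord => uInf (x 0)) strip :=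
  (h.u_tendsto.continuousOn <| .of_forall fun i => (hw i).u_smooth.continuousOn).comp
    (continuous_apply 0).continuousOn fun _ hx => Ioo_subset_Icc_self hx

lemma WarpingTendsto.continuousOn_warpedMetric (h : WarpingTendsto u φ uInf φInf)
    (hw : ∀ i, IsWarpingPair (u i) (φ i)) : ContinuousOn (warpedMetric uInf φInf) strip := by
  rw [warpedMetric_eq_expMetric h.φ_pos]
  exact continuousOn_expMetric (h.continuousOn_logPolar hw) (h.continuousOn_u hw)

theorem WarpingTendsto.tendstoLocallyUniformlyOn_warpedMetric
    (h : WarpingTendsto u φ uInf φInf) (hw : ∀ i, IsWarpingPair (u i) (φ i)) :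
    TendstoLocallyUniformlyOn (fun i => warpedMetric (u i) (φ i)) (warpedMetric uInf φInf)
      atTop strip := by
  simp only [warpedMetric_eq_expMetric (hw _).φ_pos, warpedMetric_eq_expMetric h.φ_pos]
  exact tendstoLocallyUniformlyOn_expMetric h.log_tendsto
    (((h.u_tendsto.comp fun x : Coord => x 0).mono fun _ hx =>
      Ioo_subset_Icc_self hx).tendstoLocallyUniformlyOn)
    (h.continuousOn_logPolar hw) (h.continuousOn_u hw)

theorem WarpingTendsto.tendstoUniformlyOn_φ (h : WarpingTendsto u φ uInf φInf)
    (hw : ∀ i, IsWarpingPair (u i) (φ i)) {ε : ℝ} (hε : 0 < ε) :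
    TendstoUniformlyOn φ φInf atTop (OmegaEps ε) := by
  refine tendstoUniformlyOn_OmegaEps ?_ hε
  simp only [← exp_logPolar (hw _).φ_pos, ← exp_logPolar h.φ_pos]
  exact tendstoLocallyUniformlyOn_continuous_comp Real.continuous_exp h.log_tendsto
    (h.continuousOn_logPolar hw)

theorem WarpingTendsto.tendstoUniformlyOn_warpedMetric (h : WarpingTendsto u φ uInf φInf)
    (hw : ∀ i, IsWarpingPair (u i) (φ i)) {ε : ℝ} (hε : 0 < ε) (a b : Fin 3) :
    TendstoUniformlyOn (fun i x => warpedMetric (u i) (φ i) x a b)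
      (fun x => warpedMetric uInf φInf x a b) atTop (MEps ε) := by
  have hentry : UniformContinuous fun A : Matrix (Fin 3) (Fin 3) ℝ => A a b :=
    (Pi.uniformContinuous_proj _ b).comp (Pi.uniformContinuous_proj _ a)
  exact hentry.comp_tendstoUniformlyOn <| tendstoUniformlyOn_MEps
    (h.tendstoLocallyUniformlyOn_warpedMetric hw)
    (by simp [warpedMetric, polarPt_add_int_mul_two_pi])
    (by simp [warpedMetric, polarPt_add_int_mul_two_pi]) hε

end Limits

/-! ### Convergence in `Lᵖ` -/

section StandardMetric

variable {x : Coord} {g : Coord → ℝ}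

lemma stdMetric_eq_diagonal (x : Coord) :
    stdMetric x = Matrix.diagonal fun i => stdMetric x i i := by
  rw [stdMetric]
  exact congrArg _ (funext fun i => (Matrix.diagonal_apply_eq _ i).symm)

lemma stdMetric_diag_pos (hx : x ∈ strip) (i : Fin 3) : 0 < stdMetric x i i := by
  have := sin_radius_pos hx
  rw [stdMetric, Matrix.diagonal_apply_eq]
  fin_cases i <;> dsimp <;> positivity

lemma continuous_stdMetric : Continuous stdMetric := by
  refine Continuous.matrix_diagonal (continuous_pi fun i => ?_)
  fin_cases i <;> dsimp <;> fun_prop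

lemma inv_stdMetric (hx : x ∈ strip) :
    (stdMetric x)⁻¹ = Matrix.diagonal fun i => (stdMetric x i i)⁻¹ :=
  (congrArg _ (stdMetric_eq_diagonal x)).trans
    (inv_diagonal_of_forall_ne_zero fun i => (stdMetric_diag_pos hx i).ne')

lemma sqrt_det_stdMetric (hx : x ∈ strip) :
    √(stdMetric x).det = π / 2 * Real.sin (π * x 0 / 2) := by
  have := sin_radius_pos hx
  rw [stdMetric, Matrix.det_diagonal, Fin.prod_univ_three]
  refine (congrArg _ ?_).trans (Real.sqrt_sq (by positivity))
  simp only [Matrix.cons_val]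
  ring

lemma box_subset_strip : box ⊆ strip := fun _ hx => hx.1

lemma volume_box_lt_top : volume box < ⊤ := by
  refine (measure_mono fun x hx => ?_).trans_lt
    (isCompact_Icc (a := (0 : Coord)) (b := ![2, 2 * π, 2 * π])).measure_lt_top
  constructor <;> intro i <;> fin_cases i
  exacts [hx.1.1.le, hx.2.1.1.le, hx.2.2.1.le, hx.1.2.le, hx.2.1.2.le, hx.2.2.2.le]

lemma volMeasure_absolutelyContinuous (G : CoordTensor) : volMeasure G ≪ volume.restrict box :=
  withDensity_absolutelyContinuous _ _

lemma ae_mem_strip (G : CoordTensor) : ∀ᵐ x ∂volMeasure G, x ∈ strip :=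
  (volMeasure_absolutelyContinuous G).ae_le
    ((ae_restrict_mem measurableSet_box).mono box_subset_strip)

lemma aestronglyMeasurable_volMeasure (hg : ContinuousOn g strip) (G : CoordTensor) :
    AEStronglyMeasurable g (volMeasure G) :=
  ((hg.mono box_subset_strip).aestronglyMeasurable measurableSet_box).mono_ac
    (volMeasure_absolutelyContinuous G)

end StandardMetric

section Majorant

variable {r : ℝ}

lemma sin_radius_le (hr : r ∈ Ioo (0 : ℝ) 2) : Real.sin (π * r / 2) ≤ π / 2 * (r * (2 - r)) := by
  have hleft : Real.sin (π * r / 2) ≤ π * r / 2 :=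
    Real.sin_le (by have := hr.1; positivity)
  have hright : Real.sin (π * r / 2) ≤ π - π * r / 2 := by
    rw [← Real.sin_pi_sub]
    exact Real.sin_le (by nlinarith [hr.2, Real.pi_pos])
  rcases le_total r 1 with h | h
  · nlinarith [mul_nonneg hr.1.le (sub_nonneg.2 h), Real.pi_pos]
  · nlinarith [mul_nonneg (sub_nonneg.2 hr.2.le) (sub_nonneg.2 h), Real.pi_pos]

lemma min_le_sin_radius (hr : r ∈ Ioo (0 : ℝ) 2) : min r (2 - r) ≤ Real.sin (π * r / 2) := by
  rcases le_total r 1 with h | h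
  · refine (min_le_left _ _).trans ?_
    have hJordan := Real.mul_le_sin (x := π * r / 2) (by have := hr.1; positivity)
      (by nlinarith [Real.pi_pos])
    rwa [show 2 / π * (π * r / 2) = r by field_simp] at hJordan
  · refine (min_le_right _ _).trans ?_
    have hJordan := Real.mul_le_sin (x := π - π * r / 2) (by nlinarith [hr.2, Real.pi_pos])
      (by nlinarith [Real.pi_pos])
    rwa [Real.sin_pi_sub, show 2 / π * (π - π * r / 2) = 2 - r by field_simp] at hJordan

lemma continuousOn_abs_logRatio : ContinuousOn (fun x : Coord => |logRatio (x 0)|) strip := by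
  have hlogRatio : ContinuousOn logRatio (Ioo 0 2) := fun r hr =>
    (hasDerivAt_logRatio hr).continuousAt.continuousWithinAt
  exact (hlogRatio.comp (f := fun x : Coord => x 0) (by fun_prop) fun _ hx => hx).abs

theorem integrable_exp_abs_logRatio :
    Integrable (fun x => Real.exp |logRatio (x 0)|) (volMeasure stdMetric) := by
  have hdensity : Measurable fun x : Coord => ENNReal.ofReal √(stdMetric x).det :=
    continuous_stdMetric.matrix_det.sqrt.measurable.ennreal_ofReal
  rw [volMeasure, integrable_withDensity_iff_integrable_smul' hdensity (by simp)]
  have hlogRatio : Measurable logRatio := by unfold logRatio; fun_prop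
  refine Measure.integrableOn_of_bounded (M := π ^ 2) volume_box_lt_top.ne
    (hdensity.ennreal_toReal.mul (by fun_prop)).aestronglyMeasurable ?_
  filter_upwards [ae_restrict_mem measurableSet_box] with x hx
  have hr : x 0 ∈ Ioo (0 : ℝ) 2 := hx.1
  have hpos : 0 < x 0 * (2 - x 0) := mul_pos hr.1 (sub_pos.2 hr.2)
  have hsin := sin_radius_pos hr
  rw [ENNReal.toReal_ofReal (Real.sqrt_nonneg _), sqrt_det_stdMetric hr, smul_eq_mul,
    Real.norm_of_nonneg (by positivity)]
  calc π / 2 * Real.sin (π * x 0 / 2) * Real.exp |logRatio (x 0)|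
      ≤ π / 2 * (π / 2 * (x 0 * (2 - x 0))) * (4 / (x 0 * (2 - x 0))) := by
        gcongr
        exacts [sin_radius_le hr, exp_abs_logRatio_le hr]
    _ = π ^ 2 * ((x 0 * (2 - x 0)) / (x 0 * (2 - x 0))) := by ring
    _ = π ^ 2 := by rw [div_self hpos.ne', mul_one]

theorem memLp_exp_abs_logRatio {p : ℝ≥0∞} (hp₀ : p ≠ 0) (hp : p ≠ ⊤) (C : ℝ) :
    MemLp (fun x => Real.exp (2 * (C + 1 / (2 * p.toReal) * |logRatio (x 0)|))) p
      (volMeasure stdMetric) := by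
  have hp' : 0 < p.toReal := ENNReal.toReal_pos hp₀ hp
  have hcont : ContinuousOn (fun x : Coord =>
      Real.exp (2 * (C + 1 / (2 * p.toReal) * |logRatio (x 0)|))) strip := by
    have := continuousOn_abs_logRatio
    fun_prop
  refine (integrable_norm_rpow_iff (aestronglyMeasurable_volMeasure hcont _) hp₀ hp).1 ?_
  refine (integrable_exp_abs_logRatio.const_mul (Real.exp (2 * p.toReal * C))).congr
    (.of_forall fun x => ?_)
  dsimp only
  rw [Real.norm_of_nonneg (Real.exp_pos _).le, ← Real.exp_mul, ← Real.exp_add]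
  congr 1
  field_simp

end Majorant

section TensorNorm

variable {T : CoordTensor} {x : Coord}

lemma continuous_sqrt_trace_mul (A : Matrix (Fin 3) (Fin 3) ℝ) :
    Continuous fun B : Matrix (Fin 3) (Fin 3) ℝ => √(A * B * A * B).trace := by
  fun_prop

lemma continuousOn_tensorNorm (hT : ContinuousOn T strip) : ContinuousOn (tensorNorm T) strip := by
  have hinv : ContinuousOn (fun x => (stdMetric x)⁻¹) strip := by
    refine ContinuousOn.congr (continuous_id.matrix_diagonal.comp_continuousOn
      (continuousOn_pi.2 fun i => ContinuousOn.inv₀ ?_ fun x hx => (stdMetric_diag_pos hx i).ne'))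
      fun x hx => inv_stdMetric hx
    exact (continuous_stdMetric.matrix_elem i i).continuousOn
  exact Continuous.comp_continuousOn (g := fun A : Matrix (Fin 3) (Fin 3) ℝ => √A.trace)
    (by fun_prop) (((hinv.mul hT).mul hinv).mul hT)

lemma tendsto_tensorNorm_sub {F : ℕ → CoordTensor}
    (h : Tendsto (fun i => F i x) atTop (𝓝 (T x))) :
    Tendsto (fun i => tensorNorm (F i - T) x) atTop (𝓝 0) := by
  have := ((continuous_sqrt_trace_mul (stdMetric x)⁻¹).tendsto (T x - T x)).comp
    (h.sub_const (T x))
  simp only [sub_self, mul_zero, Matrix.trace_zero, Real.sqrt_zero] at this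
  exact this

lemma tensorNorm_le_of_diagonal (hx : x ∈ strip) {d : Fin 3 → ℝ} {m : ℝ} (hm : 0 ≤ m)
    (hT : T x = Matrix.diagonal d) (hd : ∀ i, |d i| ≤ m * stdMetric x i i) :
    tensorNorm T x ≤ 3 * m := by
  have hterm (i) : (stdMetric x i i)⁻¹ * d i * (stdMetric x i i)⁻¹ * d i ≤ m ^ 2 := by
    have hs := stdMetric_diag_pos hx i
    calc (stdMetric x i i)⁻¹ * d i * (stdMetric x i i)⁻¹ * d i
        = (|d i| / stdMetric x i i) ^ 2 := by rw [div_pow, sq_abs]; ring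
      _ ≤ m ^ 2 := by
        gcongr
        exact (div_le_iff₀ hs).2 (hd i)
  rw [tensorNorm, inv_stdMetric hx, hT]
  simp only [Matrix.diagonal_mul_diagonal, Matrix.trace_diagonal]
  refine Real.sqrt_le_iff.2 ⟨by positivity, (Finset.sum_le_sum fun i _ => hterm i).trans ?_⟩
  rw [Finset.sum_const, Finset.card_univ, Fintype.card_fin, nsmul_eq_mul]
  push_cast
  nlinarith [sq_nonneg m]

end TensorNorm

section Domination

/-- The hypotheses on a pair `(v, ψ)` under which the `g₀`-norm of `warpedMetric v ψ` is at most a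
multiple of `exp (2 (C + η |logRatio r|))`, which is in `Lᵖ` for `η = 1 / (2p)`. -/
structure DominatedPair (C η : ℝ) (v : ℝ → ℝ) (ψ : S2 → ℝ) : Prop where
  continuousOn : ContinuousOn (warpedMetric v ψ) strip
  pos : ∀ q, 0 < ψ q
  abs_logPolar_le : ∀ r ∈ Ioo (0 : ℝ) 2, ∀ θ, |logPolar ψ r θ| ≤ C + η * |logRatio r|
  nonneg : ∀ r ∈ Ioo (0 : ℝ) 2, 0 ≤ v r
  le_min : ∀ r ∈ Ioo (0 : ℝ) 2, v r ≤ min r (2 - r)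

variable {C η : ℝ} {v w : ℝ → ℝ} {ψ χ : S2 → ℝ} {x : Coord}

lemma DominatedPair.diag_le (h : DominatedPair C η v ψ) (hx : x ∈ strip) (i : Fin 3) :
    warpedMetric v ψ x i i ≤
      Real.exp (2 * (C + η * |logRatio (x 0)|)) * stdMetric x i i := by
  obtain ⟨hneg, hpos⟩ := abs_le.1 (h.abs_logPolar_le _ hx (x 1))
  have hexp_neg : Real.exp (-2 * logPolar ψ (x 0) (x 1)) ≤
      Real.exp (2 * (C + η * |logRatio (x 0)|)) := Real.exp_le_exp.2 (by linarith)
  have hexp : Real.exp (2 * logPolar ψ (x 0) (x 1)) ≤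
      Real.exp (2 * (C + η * |logRatio (x 0)|)) := Real.exp_le_exp.2 (by linarith)
  rw [warpedMetric_eq_expMetric h.pos]
  fin_cases i
  · exact hexp_neg.trans (le_mul_of_one_le_right (Real.exp_pos _).le
      (one_le_pow₀ (by linarith [Real.pi_gt_three])))
  · exact mul_le_mul hexp_neg (pow_le_pow_left₀ (h.nonneg _ hx)
      ((h.le_min _ hx).trans (min_le_sin_radius hx)) 2) (sq_nonneg _) (Real.exp_pos _).le
  · exact hexp.trans (mul_one _).ge

lemma warpedMetric_eq_diagonal (v : ℝ → ℝ) (ψ : S2 → ℝ) (x : Coord) :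
    warpedMetric v ψ x = Matrix.diagonal fun i => warpedMetric v ψ x i i := by
  rw [warpedMetric]
  exact congrArg _ (funext fun i => (Matrix.diagonal_apply_eq _ i).symm)

lemma warpedMetric_diag_nonneg (v : ℝ → ℝ) (ψ : S2 → ℝ) (x : Coord) (i : Fin 3) :
    0 ≤ warpedMetric v ψ x i i := by
  rw [warpedMetric, Matrix.diagonal_apply_eq]
  fin_cases i <;> dsimp <;> positivity

lemma DominatedPair.tensorNorm_le (h : DominatedPair C η v ψ) (hx : x ∈ strip) :
    tensorNorm (warpedMetric v ψ) x ≤ 3 * Real.exp (2 * (C + η * |logRatio (x 0)|)) :=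
  tensorNorm_le_of_diagonal hx (Real.exp_pos _).le (warpedMetric_eq_diagonal v ψ x) fun i => by
    rw [abs_of_nonneg (warpedMetric_diag_nonneg v ψ x i)]
    exact h.diag_le hx i

lemma DominatedPair.tensorNorm_sub_le (h : DominatedPair C η v ψ) (h' : DominatedPair C η w χ)
    (hx : x ∈ strip) : tensorNorm (warpedMetric v ψ - warpedMetric w χ) x
      ≤ 3 * Real.exp (2 * (C + η * |logRatio (x 0)|)) := by
  refine tensorNorm_le_of_diagonal hx (Real.exp_pos _).le (d := fun i =>
    warpedMetric v ψ x i i - warpedMetric w χ x i i) ?_ fun i =>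
    abs_sub_le_of_nonneg_of_le (warpedMetric_diag_nonneg v ψ x i) (h.diag_le hx i)
      (warpedMetric_diag_nonneg w χ x i) (h'.diag_le hx i)
  rw [Pi.sub_apply, warpedMetric_eq_diagonal v, warpedMetric_eq_diagonal w, Matrix.diagonal_sub]
  simp only [Matrix.diagonal_apply_eq]

theorem tendsto_eLpNorm_zero_of_dominated {α : Type*} [MeasurableSpace α] {μ : Measure α}
    {p : ℝ≥0∞} (hp₀ : p ≠ 0) (hp : p ≠ ⊤) {F : ℕ → α → ℝ} {G : α → ℝ}
    (hF : ∀ i, AEStronglyMeasurable (F i) μ) (hG : MemLp G p μ)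
    (hFG : ∀ i, ∀ᵐ x ∂μ, ‖F i x‖ ≤ G x) (hlim : ∀ᵐ x ∂μ, Tendsto (fun i => F i x) atTop (𝓝 0)) :
    Tendsto (fun i => eLpNorm (F i) p μ) atTop (𝓝 0) := by
  have hp' : 0 < p.toReal := ENNReal.toReal_pos hp₀ hp
  have hrpow {q : ℝ} (hq : 0 < q) : Tendsto (fun y : ℝ≥0∞ => y ^ q) (𝓝 0) (𝓝 0) := by
    simpa only [ENNReal.zero_rpow_of_pos hq] using
      (ENNReal.continuous_rpow_const (y := q)).tendsto 0
  have hint : Tendsto (fun i => ∫⁻ x, ‖F i x‖ₑ ^ p.toReal ∂μ) atTop (𝓝 (∫⁻ _, 0 ∂μ)) := by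
    refine tendsto_lintegral_of_dominated_convergence' (fun x => ‖G x‖ₑ ^ p.toReal)
      (fun i => (hF i).enorm.pow_const _) (fun i => ?_)
      ((eLpNorm_lt_top_iff_lintegral_rpow_enorm_lt_top hp₀ hp).1 hG.2).ne ?_
    · filter_upwards [hFG i] with x hx
      gcongr
      exact enorm_le_iff_norm_le.2 (hx.trans (le_abs_self _))
    · filter_upwards [hlim] with x hx
      exact (hrpow hp').comp (by simpa only [enorm_zero] using hx.enorm)
  rw [lintegral_zero] at hint
  simp only [eLpNorm_eq_lintegral_rpow_enorm_toReal hp₀ hp]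
  exact (hrpow (one_div_pos.2 hp')).comp hint

variable {p : ℝ≥0∞}

lemma norm_tensorNorm (T : CoordTensor) (x : Coord) : ‖tensorNorm T x‖ = tensorNorm T x :=
  Real.norm_of_nonneg (Real.sqrt_nonneg _)

lemma continuousOn_entry {T : CoordTensor} (hT : ContinuousOn T strip) (a b : Fin 3) :
    ContinuousOn (fun x => T x a b) strip :=
  continuousOn_pi.1 (continuousOn_pi.1 hT a) b

lemma DominatedPair.memTensorLp (hp₀ : p ≠ 0) (hp : p ≠ ⊤)
    (h : DominatedPair C (1 / (2 * p.toReal)) v ψ) : MemTensorLp (warpedMetric v ψ) p := by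
  refine ⟨fun a b => aestronglyMeasurable_volMeasure (continuousOn_entry h.continuousOn a b) _,
    ((memLp_exp_abs_logRatio hp₀ hp C).const_mul 3).mono'
      (aestronglyMeasurable_volMeasure (continuousOn_tensorNorm h.continuousOn) _) ?_⟩
  filter_upwards [ae_mem_strip stdMetric] with x hx
  exact (norm_tensorNorm _ x).trans_le (h.tensorNorm_le hx)

theorem tendstoTensorLp_of_dominatedPair (hp₀ : p ≠ 0) (hp : p ≠ ⊤) {V : ℕ → ℝ → ℝ}
    {Ψ : ℕ → S2 → ℝ} (h : ∀ i, DominatedPair C (1 / (2 * p.toReal)) (V i) (Ψ i))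
    (h' : DominatedPair C (1 / (2 * p.toReal)) w χ) (hlim : ∀ x ∈ strip,
      Tendsto (fun i => warpedMetric (V i) (Ψ i) x) atTop (𝓝 (warpedMetric w χ x))) :
    TendstoTensorLp (fun i => warpedMetric (V i) (Ψ i)) (warpedMetric w χ) p := by
  refine ⟨fun i => (h i).memTensorLp hp₀ hp, h'.memTensorLp hp₀ hp,
    tendsto_eLpNorm_zero_of_dominated hp₀ hp (fun i => aestronglyMeasurable_volMeasure
      (continuousOn_tensorNorm ((h i).continuousOn.sub h'.continuousOn)) _)
      ((memLp_exp_abs_logRatio hp₀ hp C).const_mul 3) (fun i => ?_) ?_⟩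
  · filter_upwards [ae_mem_strip stdMetric] with x hx
    exact (norm_tensorNorm _ x).trans_le ((h i).tensorNorm_sub_le h' hx)
  · filter_upwards [ae_mem_strip stdMetric] with x hx
    exact tendsto_tensorNorm_sub (hlim x hx)

end Domination

theorem WarpingTendsto.tendstoTensorLp {V₀ A₀ : ℝ} (hA₀ : 0 < A₀) {u : ℕ → ℝ → ℝ}
    {φ : ℕ → S2 → ℝ} {uInf : ℝ → ℝ} {φInf : S2 → ℝ} (h : WarpingTendsto u φ uInf φInf)
    (hadm : ∀ i, AdmissiblePair V₀ A₀ (u i) (φ i)) {p : ℝ≥0∞} (hp₀ : p ≠ 0) (hp : p ≠ ⊤) :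
    TendstoTensorLp (fun i => warpedMetric (u i) (φ i)) (warpedMetric uInf φInf) p := by
  have hw i := (hadm i).toIsWarpingPair
  have hκ i := (hadm i).noncollapsedPair
  have hp' : 0 < p.toReal := ENNReal.toReal_pos hp₀ hp
  obtain ⟨C, hC⟩ := exists_abs_logPolar_le hA₀ V₀ (η := 1 / (2 * p.toReal)) (by positivity)
  refine tendstoTensorLp_of_dominatedPair (C := C) hp₀ hp
    (fun i => ⟨(hw i).continuousOn_warpedMetric, (hw i).φ_pos, hC _ _ (hadm i),
      fun r hr => ((hw i).u_pos r hr).le,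
      fun r hr => (hw i).u_le_min (hadm i).gradientBound (Ioo_subset_Icc_self hr)⟩)
    ⟨h.continuousOn_warpedMetric hw, h.φ_pos,
      fun r hr θ => h.abs_logPolar_le hr fun i => hC _ _ (hadm i) r hr θ,
      fun r hr => ge_of_tendsto' (h.u_tendsto.tendsto_at (Ioo_subset_Icc_self hr)) fun i =>
        ((hw i).u_pos r hr).le,
      fun r hr => h.u_le_min hκ (Ioo_subset_Icc_self hr)⟩
    fun x hx => (h.tendstoLocallyUniformlyOn_warpedMetric hw).tendsto_at hx

theorem WarpingTendsto.u_pos {V₀ A₀ : ℝ} (hA₀ : 0 < A₀) {u : ℕ → ℝ → ℝ}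
    {φ : ℕ → S2 → ℝ} {uInf : ℝ → ℝ} {φInf : S2 → ℝ} (h : WarpingTendsto u φ uInf φInf)
    (hadm : ∀ i, AdmissiblePair V₀ A₀ (u i) (φ i)) {r : ℝ} (hr : r ∈ Ioo (0 : ℝ) 2) :
    0 < uInf r := by
  have hpos : 0 < r * (2 - r) := mul_pos hr.1 (sub_pos.2 hr.2)
  exact (by positivity : 0 < A₀ / (16 * π ^ 2) * (r * (2 - r))).trans_le
    (h.le_u (fun i => (hadm i).noncollapsedPair) (Ioo_subset_Icc_self hr))

end WarpedS2S1

end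

open WarpedS2S1 in
theorem theorem1p3 (V₀ A₀ : ℝ) (hA₀ : 0 < A₀)
    (u : ℕ → ℝ → ℝ) (φ : ℕ → WarpedS2S1.S2 → ℝ)
    (hsmooth : ∀ i, WarpedS2S1.IsWarpingPair (u i) (φ i))
    (hscal : ∀ i, ∀ x ∈ WarpedS2S1.strip,
      0 ≤ WarpedS2S1.scalarCurvature (WarpedS2S1.warpedMetric (u i) (φ i)) x)
    (hvol : ∀ i, WarpedS2S1.vol (WarpedS2S1.warpedMetric (u i) (φ i)) ≤ ENNReal.ofReal V₀)
    (hminA : ∀ i, ENNReal.ofReal A₀ ≤ WarpedS2S1.minA (WarpedS2S1.warpedMetric (u i) (φ i))) :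
    ∃ (σ : ℕ → ℕ) (uInf : ℝ → ℝ) (φInf : WarpedS2S1.S2 → ℝ),
      StrictMono σ ∧
      -- the limits that define `g_∞`
      TendstoUniformlyOn (fun i => u (σ i)) uInf atTop (Icc 0 2) ∧
      (∀ ε ∈ Ioo (0 : ℝ) 1,
        TendstoUniformlyOn (fun i => φ (σ i)) φInf atTop (WarpedS2S1.OmegaEps ε)) ∧
      (∀ r ∈ Ioo (0 : ℝ) 2, 0 < uInf r) ∧
      (∀ r ∈ Ioo (0 : ℝ) 2, ∀ θ : ℝ, 0 < φInf (WarpedS2S1.polarPt r θ)) ∧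
      -- convergence in `Lᵖ(M, g₀)`
      (∀ p : ℝ≥0∞, 1 ≤ p → p < ⊤ →
        WarpedS2S1.TendstoTensorLp (fun i => WarpedS2S1.warpedMetric (u (σ i)) (φ (σ i)))
          (WarpedS2S1.warpedMetric uInf φInf) p) ∧
      -- uniform convergence of the coefficients on the interior regions
      (∀ ε ∈ Ioo (0 : ℝ) 1, ∀ a b : Fin 3,
        TendstoUniformlyOn
          (fun i x => WarpedS2S1.warpedMetric (u (σ i)) (φ (σ i)) x a b)
          (fun x => WarpedS2S1.warpedMetric uInf φInf x a b) atTop (WarpedS2S1.MEps ε)) := by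
  have hadm i : AdmissiblePair V₀ A₀ (u i) (φ i) := ⟨hsmooth i, hscal i, hvol i, hminA i⟩
  obtain ⟨σ, uInf, φInf, hσ, hlim⟩ := exists_subseq_warpingTendsto hA₀ hadm
  have hw i := hsmooth (σ i)
  exact ⟨σ, uInf, φInf, hσ, hlim.u_tendsto,
    fun ε hε => hlim.tendstoUniformlyOn_φ hw hε.1,
    fun r hr => hlim.u_pos hA₀ (fun i => hadm (σ i)) hr,
    fun _ _ _ => hlim.φ_pos _,
    fun p hp₁ hp => hlim.tendstoTensorLp hA₀ (fun i => hadm (σ i)) (one_pos.trans_le hp₁).ne' hp.ne,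
    fun ε hε a b => hlim.tendstoUniformlyOn_warpedMetric hw hε.1 a b⟩
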